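/- Let $X$ be a finite alphabet with $|X|\ge 2$ and let $G$ be a self-similar group over $X$: a group acting faithfully on the set $X^*$ of finite words by length-preserving permutations such that for all $g\in G$, $x\in X$ there is $g|_x\in G$ (the section of $g$ at $x$) with $g(xw)=g(x)\,g|_x(w)$ for all $w\in X^*$; put $g|_{xv}=(g|_x)|_v$. A finite automaton in $G$ is a finite subset of $G$ closed under taking sections; its state diagram is the digraph whose vertices are its elements, with an edge $a\to a|_x$ labelled $x\mid a(x)$ for each state $a$ and letter $x$. The group $G$ is contracting if there is a finite automaton $N\subseteq G$ such that for every $g\in G$ there is $n$ with $g|_w\in N$ for all words $w$ of length $n$. For a field $K$, the Nekrashevych algebra $N_K(G,X)$ is the unital $*$-algebra over $K$ (with trivial involution on $K$) generated by $X\cup G$, where the identity of $G$ is the identity of the algebra, with relations $g^*=g^{-1}$, $g\cdot h=gh$, $gx=g(x)\,g|_x$, $y^*x=\delta_{x,y}$ and $\sum_{x\in X}xx^*=1$ for $g,h\in G$ and $x,y\in X$. **Theorem.** Suppose that $G$ is contracting and is generated by a finite automaton $A$, given by its state diagram. Then the simplicity of $N_K(G,X)$ depends only on the characteristic of $K$.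 Either $N_K(G,X)$ is non-simple for every field $K$, or there is a finite set $P$ of primes such that, for every field $K$, the algebra $N_K(G,X)$ is simple if and only if the characteristic of $K$ is not in $P$. Furthermore, there is a single algorithm which, given as input the state diagram of any finite automaton $A$ generating a contracting self-similar group $G$ over a finite alphabet $X$ with $|X|\ge 2$, halts, decides which of the two cases holds and, in the second case, outputs the finite set $P$. -/

import Mathlib

universe u v w w'

/-- A self-similar group `G` over the alphabet `X`: a faithful action of `G` on the set of finite
words over `X` by length-preserving permutations such that for all `g` and every letter `x`
there is an element `h` of `G` (the section of `g` at `x`) with `g(xw) = g(x) h(w)` for all words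
`w`. -/
class SelfSimilarGroup (G X : Type*) [Group G] [MulAction G (List X)] : Prop
    extends FaithfulSMul G (List X) where
  length_smul : ∀ (g : G) (w : List X), (g • w).length = w.length
  exists_section : ∀ (g : G) (x : X), ∃ h : G, ∀ w : List X,
    g • (x :: w) = (g • [x]) ++ (h • w)

namespace SelfSimilarGroup

section Basic

variable {G X : Type*} [Group G] [MulAction G (List X)] [SelfSimilarGroup G X]

/-- The image `g(x)` of the letter `x` under `g`, as a letter. -/
def letter (g : G) (x : X) : X :=
  (g • [x]).head (by
    intro h
    have h1 := length_smul g [x]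
    rw [h] at h1
    simp at h1)

/-- The section `g|_x` of `g` at the letter `x`. -/
noncomputable def sect (g : G) (x : X) : G := Classical.choose (exists_section g x)

theorem smul_singleton (g : G) (x : X) : g • [x] = [letter g x] := by
  obtain ⟨y, hy⟩ := List.length_eq_one_iff.mp (length_smul g [x])
  simp [letter, hy]

theorem smul_cons (g : G) (x : X) (w : List X) :
    g • (x :: w) = letter g x :: (sect g x • w) := by
  have h : g • (x :: w) = (g • [x]) ++ (sect g x • w) :=
    Classical.choose_spec (exists_section g x) w
  rwa [smul_singleton] at h

/-- The section `g|_w` of `g` at the word `w`: `g|_{xv} = (g|_x)|_v`. -/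
noncomputable def sectWord (g : G) : List X → G
  | [] => g
  | x :: v => sectWord (sect g x) v

end Basic

/-- A (finite) automaton in `G`: a finite subset of `G` closed under taking sections. -/
structure Automaton (G X : Type*) [Group G] [MulAction G (List X)] [SelfSimilarGroup G X] where
  states : Finset G
  sect_mem : ∀ a ∈ states, ∀ x : X, sect a x ∈ states

/-- `G` is contracting: there is a finite automaton `N` in `G` such that for every `g` there
is `n` for which all sections of `g` at words of length `n` lie in `N`. -/
def IsContracting (G X : Type*) [Group G] [MulAction G (List X)] [SelfSimilarGroup G X] : Prop :=
  ∃ N : Automaton G X, ∀ g : G, ∃ n : ℕ, ∀ w : List X, w.length = n → sectWord g w ∈ N.states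

/-- The automaton `A` generates the group `G`. -/
def Automaton.Generates {G X : Type*} [Group G] [MulAction G (List X)] [SelfSimilarGroup G X]
    (A : Automaton G X) : Prop :=
  Subgroup.closure (A.states : Set G) = ⊤

/-- The state diagram of the automaton `A` as finite data, relative to an enumeration of
the alphabet as `0, …, d - 1` and of the states as `0, …, n - 1`: the number `d`, together with the
table whose entry in row `i` and column `j` is the pair (number of the letter `a(x)`, number of the
state `a|_x`), where `a` is the state with number `i` and `x` is the letter with number `j`;
this entry is the edge from `a` to `a|_x` labelled by `x | a(x)`. -/
noncomputable def Automaton.stateDiagram {G X : Type*} [Group G] [MulAction G (List X)]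
    [SelfSimilarGroup G X] (A : Automaton G X) {d n : ℕ} (eX : Fin d ≃ X)
    (eA : Fin n ≃ A.states) : ℕ × List (List (ℕ × ℕ)) :=
  (d, List.ofFn fun i : Fin n => List.ofFn fun j : Fin d =>
    (((eX.symm (letter (eA i : G) (eX j)) : Fin d) : ℕ),
      ((eA.symm ⟨sect (eA i : G) (eX j), A.sect_mem _ (eA i).2 _⟩ : Fin n) : ℕ)))

/-- Generators of the Nekrashevych algebra: the letters `x`, their adjoints `x^*`, and the
elements `g` of the group. The adjoint of the generator `g` is the generator `g⁻¹`. -/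
inductive NekGen (G X : Type*) : Type _
  | letter (x : X) : NekGen G X
  | letterStar (x : X) : NekGen G X
  | elt (g : G) : NekGen G X

/-- The generator of the free algebra that corresponds to the letter `x`. -/
def gX (K : Type*) [Field K] (G : Type*) {X : Type*} (x : X) : FreeAlgebra K (NekGen G X) :=
  FreeAlgebra.ι K (NekGen.letter x)

/-- The generator of the free algebra that corresponds to `x^*`. -/
def gXs (K : Type*) [Field K] (G : Type*) {X : Type*} (x : X) : FreeAlgebra K (NekGen G X) :=
  FreeAlgebra.ι K (NekGen.letterStar x)

/-- The generator of the free algebra that corresponds to the group element `g`. -/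
def gG (K : Type*) [Field K] {G : Type*} (X : Type*) (g : G) : FreeAlgebra K (NekGen G X) :=
  FreeAlgebra.ι K (NekGen.elt g)

/-- The defining relations of the Nekrashevych algebra as a `*`-algebra. The set of relations is
closed under `*` (which reverses products, exchanges `x` and `x^*`, and sends `g` to `g⁻¹`), so that
the algebra they present is the `*`-algebra they present. -/
inductive NekRel (K : Type*) [Field K] (G X : Type*) [Fintype X] [Group G]
    [MulAction G (List X)] [SelfSimilarGroup G X] :
    FreeAlgebra K (NekGen G X) → FreeAlgebra K (NekGen G X) → Prop
  /-- the identity of `G` is the identity of the algebra -/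
  | one : NekRel K G X (gG K X 1) 1
  /-- `g · h = gh` -/
  | mul (g h : G) : NekRel K G X (gG K X g * gG K X h) (gG K X (g * h))
  /-- `g x = g(x) g|_x` -/
  | ss (g : G) (x : X) : NekRel K G X (gG K X g * gX K G x)
      (gX K G (SelfSimilarGroup.letter g x) * gG K X (sect g x))
  /-- the adjoint `x^* g⁻¹ = (g|_x)⁻¹ g(x)^*` of the previous relation -/
  | ss_star (g : G) (x : X) : NekRel K G X (gXs K G x * gG K X g⁻¹)
      (gG K X (sect g x)⁻¹ * gXs K G (SelfSimilarGroup.letter g x))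
  /-- `x^* x = 1` -/
  | ck1_same (x : X) : NekRel K G X (gXs K G x * gX K G x) 1
  /-- `y^* x = 0` for distinct letters `x`, `y` -/
  | ck1_ne (x y : X) : x ≠ y → NekRel K G X (gXs K G y * gX K G x) 0
  /-- the sum of `x x^*` over all letters `x` equals `1` -/
  | ck2 : NekRel K G X (∑ x : X, gX K G x * gXs K G x) 1

/-- The Nekrashevych algebra of the self-similar group `G` over the finite alphabet `X`, with
coefficients in the field `K`. -/
abbrev NekrashevychAlgebra (K : Type*) [Field K] (G X : Type*) [Fintype X] [Group G]
    [MulAction G (List X)] [SelfSimilarGroup G X] :=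
  RingQuot (NekRel K G X)

end SelfSimilarGroup
/-!
An element `a` of the Nekrashevych algebra is singular if every word extends to a word `w` with
`a w = 0`. The singular elements form the largest proper ideal, so the algebra is simple if and only
if none but zero are singular. Multiplication by long words on the right turns `a` into a
combination of monomials `u g`, whose singularity and vanishing are linear conditions on the
coefficients, defined over the prime field. Hence only the characteristic matters. Reduction modulo
`p` and descent on the sum of the absolute values of integer coefficients show that simplicity in
some characteristic `p` implies simplicity in characteristic zero.

If `G` is contracting, finitely many group elements suffice. Each word `w` divides them into classes
of elements `g` with the same monomial `g w`, and `w` is resolving if the classes are already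
distinguished by the word `g(w)`. The algebra is simple over `K` if and only if the class vectors at
all words of some length lie in the span over `K` of the class vectors at resolving words. The class
vectors at `w` are determined by a state of `w`, for which there are finitely many possibilities, so
that finitely many vectors are involved. If they satisfy the condition over `ℚ`, they satisfy it
modulo every prime that does not divide a common denominator. All of this can be computed from the
state diagram, since a search finds a length at which words distinguish the group elements involved.
-/

namespace SelfSimilarGroup

section Words

variable {G X : Type*} [Group G] [MulAction G (List X)] [SelfSimilarGroup G X]

theorem smul_nil (g : G) : g • ([] : List X) = [] :=
  List.length_eq_zero_iff.mp (length_smul g [])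

theorem smul_append (g : G) (v w : List X) : g • (v ++ w) = g • v ++ sectWord g v • w := by
  induction v generalizing g with
  | nil => simp [smul_nil, sectWord]
  | cons x v ih => simp [smul_cons, sectWord, ih]

theorem sectWord_append (g : G) (v w : List X) :
    sectWord g (v ++ w) = sectWord (sectWord g v) w := by
  induction v generalizing g with
  | nil => rfl
  | cons x v ih => simp [sectWord, ih]

theorem eq_of_forall_smul_eq (X : Type*) [MulAction G (List X)] [SelfSimilarGroup G X] {g h : G}
    (H : ∀ w : List X, g • w = h • w) : g = h :=
  FaithfulSMul.eq_of_smul_eq_smul H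

theorem sectWord_mul (g h : G) (w : List X) :
    sectWord (g * h) w = sectWord g (h • w) * sectWord h w := by
  refine eq_of_forall_smul_eq X fun z => List.append_cancel_left (as := (g * h) • w) ?_
  rw [← smul_append, mul_smul, mul_smul, mul_smul, smul_append h, smul_append g]

theorem sectWord_one (w : List X) : sectWord (1 : G) w = 1 := by
  have h := sectWord_mul (1 : G) 1 w
  rw [mul_one, one_smul] at h
  exact left_eq_mul.mp h

theorem sectWord_inv (g : G) (w : List X) : sectWord g⁻¹ (g • w) = (sectWord g w)⁻¹ := by
  have h := sectWord_mul g⁻¹ g w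
  rw [inv_mul_cancel, sectWord_one] at h
  exact eq_inv_of_mul_eq_one_left h.symm

theorem letter_mul (g h : G) (x : X) : letter (g * h) x = letter g (letter h x) := by
  simpa only [smul_singleton, List.cons.injEq, and_true] using mul_smul g h [x]

theorem sect_mul (g h : G) (x : X) : sect (g * h) x = sect g (letter h x) * sect h x := by
  simpa only [smul_singleton, sectWord] using sectWord_mul g h [x]

theorem letter_one (x : X) : letter (1 : G) x = x := by
  simpa only [smul_singleton, List.cons.injEq, and_true] using one_smul G [x]

theorem sect_one (x : X) : sect (1 : G) x = 1 := sectWord_one [x]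

theorem sect_inv (g : G) (x : X) : sect g⁻¹ (letter g x) = (sect g x)⁻¹ := by
  simpa only [smul_singleton, sectWord] using sectWord_inv g [x]

theorem letter_inv (g : G) (x : X) : letter g⁻¹ (letter g x) = x := by
  simpa only [smul_singleton, List.cons.injEq, and_true] using inv_smul_smul g [x]

/-- A pair `(u, g)`, which stands for the product `u g` in the Nekrashevych algebra. -/
abbrev Monomial (G X : Type*) := List X × G

/-- Right multiplication of monomials by a word: `(u g) w = u g(w) g|_w`. -/
noncomputable def mulWord (w : List X) (t : Monomial G X) : Monomial G X :=
  (t.1 ++ t.2 • w, sectWord t.2 w)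

theorem mulWord_nil (t : Monomial G X) : mulWord [] t = t := by
  simp [mulWord, smul_nil, sectWord]

theorem mulWord_append (v w : List X) (t : Monomial G X) :
    mulWord (v ++ w) t = mulWord w (mulWord v t) := by
  simp [mulWord, smul_append, sectWord_append]

theorem length_fst_mulWord (w : List X) (t : Monomial G X) :
    (mulWord w t).1.length = t.1.length + w.length := by
  simp [mulWord, length_smul]

theorem fst_eq_of_mulWord_eq {w : List X} {t t' : Monomial G X}
    (h : mulWord w t = mulWord w t') : t.1 = t'.1 := by
  have h1 : t.1 ++ t.2 • w = t'.1 ++ t'.2 • w := congrArg Prod.fst h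
  exact (List.append_inj' h1 (by simp [length_smul])).1

/-- Two words are incomparable if neither is a prefix of the other. -/
abbrev Incomparable (u v : List X) : Prop := IncompRel (· <+: ·) u v

theorem Incomparable.append {u v : List X} (h : Incomparable u v) (a b : List X) :
    Incomparable (u ++ a) (v ++ b) := by
  have not_both {p : List X} (hu : u <+: p) (hv : v <+: p) : False :=
    (List.prefix_or_prefix_of_prefix hu hv).elim h.1 h.2
  exact ⟨fun H => not_both ((List.prefix_append u a).trans H) (List.prefix_append v b),
    fun H => not_both (List.prefix_append u a) ((List.prefix_append v b).trans H)⟩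

theorem incomparable_of_length_eq {u v : List X} (hl : u.length = v.length) (hne : u ≠ v) :
    Incomparable u v :=
  ⟨fun h => hne (h.eq_of_length hl), fun h => hne (h.eq_of_length hl.symm).symm⟩

theorem exists_append_forall_mem {α : Type*} (s : Finset α) (P : α → List X → Prop)
    (hmono : ∀ i v w, P i v → P i (v ++ w)) (hex : ∀ i ∈ s, ∀ v, ∃ w, P i (v ++ w))
    (v : List X) : ∃ w, ∀ i ∈ s, P i (v ++ w) := by
  classical
  induction s using Finset.induction_on with
  | empty => exact ⟨[], by simp⟩
  | insert a s ha ih =>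
    obtain ⟨w, hw⟩ := ih fun i hi => hex i (Finset.mem_insert_of_mem hi)
    obtain ⟨z, hz⟩ := hex a (Finset.mem_insert_self a s) (v ++ w)
    refine ⟨w ++ z, fun i hi => ?_⟩
    rw [← List.append_assoc]
    rcases Finset.mem_insert.mp hi with rfl | hi
    · exact hz
    · exact hmono i _ _ (hw i hi)

theorem exists_mulWord_eq_or_incomparable_of_append [Nontrivial X] (u z : List X) (g g' : G) :
    ∃ w, mulWord w (u, g) = mulWord w (u ++ z, g') ∨
      Incomparable (mulWord w (u, g)).1 (mulWord w (u ++ z, g')).1 := by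
  cases z with
  | nil =>
    rcases eq_or_ne g g' with rfl | hg
    · exact ⟨[], .inl (by simp)⟩
    · obtain ⟨w, hw⟩ : ∃ w : List X, g • w ≠ g' • w := by
        contrapose! hg
        exact eq_of_forall_smul_eq X hg
      exact ⟨w, .inr (incomparable_of_length_eq (by simp [length_fst_mulWord])
        (by simpa [mulWord] using hw))⟩
  | cons y z =>
    obtain ⟨y', hy'⟩ := exists_ne y
    have h : Incomparable (u ++ [y']) (u ++ [y]) :=
      incomparable_of_length_eq (by simp) (by simpa using hy')
    exact ⟨g⁻¹ • [y'], .inr (by simpa [mulWord] using h.append [] (z ++ g' • g⁻¹ • [y']))⟩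

theorem exists_mulWord_eq_or_incomparable [Nontrivial X] (t t' : Monomial G X) (v : List X) :
    ∃ w, mulWord (v ++ w) t = mulWord (v ++ w) t' ∨
      Incomparable (mulWord (v ++ w) t).1 (mulWord (v ++ w) t').1 := by
  simp only [mulWord_append]
  generalize mulWord v t = s, mulWord v t' = s'
  obtain ⟨u, g⟩ := s
  obtain ⟨u', g'⟩ := s'
  by_cases h : u <+: u'
  · obtain ⟨z, rfl⟩ := h
    exact exists_mulWord_eq_or_incomparable_of_append u z g g'
  by_cases h' : u' <+: u
  · obtain ⟨z, rfl⟩ := h'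
    obtain ⟨w, hw⟩ := exists_mulWord_eq_or_incomparable_of_append u' z g' g
    exact ⟨w, hw.imp Eq.symm IncompRel.symm⟩
  · exact ⟨[], .inr (by simpa only [mulWord_nil] using ⟨h, h'⟩)⟩

theorem exists_forall_mulWord_eq_or_incomparable [Nontrivial X] (s : Finset (Monomial G X))
    (v : List X) : ∃ w, ∀ t ∈ s, ∀ t' ∈ s, mulWord (v ++ w) t = mulWord (v ++ w) t' ∨
      Incomparable (mulWord (v ++ w) t).1 (mulWord (v ++ w) t').1 := by
  have hmono (p : Monomial G X × Monomial G X) (v w : List X)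
      (h : mulWord v p.1 = mulWord v p.2 ∨ Incomparable (mulWord v p.1).1 (mulWord v p.2).1) :
      mulWord (v ++ w) p.1 = mulWord (v ++ w) p.2 ∨
        Incomparable (mulWord (v ++ w) p.1).1 (mulWord (v ++ w) p.2).1 := by
    simp only [mulWord_append]
    exact h.imp (congrArg _) fun h => h.append _ _
  obtain ⟨w, hw⟩ := exists_append_forall_mem (s ×ˢ s) _ hmono
    (fun p _ v => exists_mulWord_eq_or_incomparable p.1 p.2 v) v
  exact ⟨w, fun t ht t' ht' => hw (t, t') (Finset.mk_mem_product ht ht')⟩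

end Words

section Singular

variable {G X : Type*} [Group G] [MulAction G (List X)] [SelfSimilarGroup G X]
  {M : Type*} [AddCommMonoid M]

/-- A combination `φ` of monomials is singular if every word extends to one that annihilates `φ`
from the right. -/
def IsSingular (φ : Monomial G X →₀ M) : Prop :=
  ∀ v : List X, ∃ w : List X, φ.mapDomain (mulWord (v ++ w)) = 0

/-- A combination `φ` of monomials is null if all words of some length annihilate `φ` from the
right. Over a field this means that it vanishes in the Nekrashevych algebra. -/
def IsNull (φ : Monomial G X →₀ M) : Prop :=
  ∃ n : ℕ, ∀ w : List X, w.length = n → φ.mapDomain (mulWord w) = 0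

variable (G X M) in
/-- All singular combinations of monomials with coefficients in `M` are null. The coefficients form
a mere monoid so that those over fields can be compared with those over `ℤ`. -/
def NoSingular : Prop := ∀ φ : Monomial G X →₀ M, IsSingular φ → IsNull φ

theorem mapDomain_mulWord_append (v w : List X) (φ : Monomial G X →₀ M) :
    φ.mapDomain (mulWord (v ++ w)) = (φ.mapDomain (mulWord v)).mapDomain (mulWord w) := by
  rw [← Finsupp.mapDomain_comp]
  congr 1
  exact funext fun t => mulWord_append v w t

theorem mapDomain_mulWord_append_eq_zero {v : List X} {φ : Monomial G X →₀ M}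
    (h : φ.mapDomain (mulWord v) = 0) (w : List X) : φ.mapDomain (mulWord (v ++ w)) = 0 := by
  rw [mapDomain_mulWord_append, h, Finsupp.mapDomain_zero]

theorem mapDomain_mulWord_eq_zero_of_le {n : ℕ} {φ : Monomial G X →₀ M}
    (h : ∀ w : List X, w.length = n → φ.mapDomain (mulWord w) = 0) (w : List X)
    (hw : n ≤ w.length) : φ.mapDomain (mulWord w) = 0 := by
  have := mapDomain_mulWord_append_eq_zero (h (w.take n) (by simpa using hw)) (w.drop n)
  rwa [List.take_append_drop] at this

theorem IsSingular.mapDomain_mulWord {φ : Monomial G X →₀ M} (h : IsSingular φ) (u : List X) :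
    IsSingular (φ.mapDomain (mulWord u)) := fun v => by
  obtain ⟨w, hw⟩ := h (u ++ v)
  exact ⟨w, by rw [← mapDomain_mulWord_append, ← List.append_assoc, hw]⟩

theorem isNull_of_forall_mapDomain_mulWord [Finite X] {φ : Monomial G X →₀ M} (n : ℕ)
    (h : ∀ w : List X, w.length = n → IsNull (φ.mapDomain (mulWord w))) : IsNull φ := by
  have hfin : {w : List X | w.length = n}.Finite := List.finite_length_eq X n
  choose! N hN using h
  refine ⟨n + hfin.toFinset.sup N, fun w hw => ?_⟩
  have htake : (w.take n).length = n := by simp; omega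
  have hle : N (w.take n) ≤ (w.drop n).length := by
    have := Finset.le_sup (f := N) (hfin.mem_toFinset.mpr htake)
    simp; omega
  have h0 := mapDomain_mulWord_eq_zero_of_le (hN _ htake) (w.drop n) hle
  rwa [← mapDomain_mulWord_append, List.take_append_drop] at h0

theorem exists_forall_support_eq_or_incomparable [Nontrivial X] (φ : Monomial G X →₀ M)
    (v : List X) : ∃ w, ∀ t ∈ (φ.mapDomain (mulWord (v ++ w))).support,
      ∀ t' ∈ (φ.mapDomain (mulWord (v ++ w))).support, t = t' ∨ Incomparable t.1 t'.1 := by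
  classical
  obtain ⟨w, hw⟩ := exists_forall_mulWord_eq_or_incomparable φ.support v
  refine ⟨w, fun t ht t' ht' => ?_⟩
  obtain ⟨s, hs, rfl⟩ := Finset.mem_image.mp (Finsupp.mapDomain_support ht)
  obtain ⟨s', hs', rfl⟩ := Finset.mem_image.mp (Finsupp.mapDomain_support ht')
  exact hw s hs s' hs'

end Singular

section LongMonomials

variable {K : Type*} [Field K] {G X : Type*}

variable (K G X) in
/-- The combinations of monomials `u g` with `n ≤ |u|`. -/
def longMonomials (n : ℕ) : Submodule K (Monomial G X →₀ K) :=
  Finsupp.supported K K {t | n ≤ t.1.length}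

theorem longMonomials_anti {m n : ℕ} (h : m ≤ n) :
    longMonomials K G X n ≤ longMonomials K G X m :=
  Finsupp.supported_mono fun _ ht => le_trans h ht

theorem single_mem_longMonomials {n : ℕ} {t : Monomial G X} (h : n ≤ t.1.length) :
    Finsupp.single t (1 : K) ∈ longMonomials K G X n :=
  Finsupp.single_mem_supported K _ h

theorem longMonomials_eq_span (n : ℕ) : longMonomials K G X n =
    Submodule.span K ((fun t => Finsupp.single t 1) '' {t : Monomial G X | n ≤ t.1.length}) :=
  Finsupp.supported_eq_span_single K _

theorem longMonomials_le_comap {n : ℕ} {V : Type*} [AddCommGroup V] [Module K V]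
    {f : (Monomial G X →₀ K) →ₗ[K] V} {p : Submodule K V}
    (h : ∀ t : Monomial G X, n ≤ t.1.length → f (Finsupp.single t 1) ∈ p) :
    longMonomials K G X n ≤ p.comap f := by
  rw [longMonomials_eq_span, Submodule.span_le]
  rintro _ ⟨t, ht, rfl⟩
  exact h t ht

theorem eqOn_longMonomials {n : ℕ} {V : Type*} [AddCommGroup V] [Module K V]
    {f g : (Monomial G X →₀ K) →ₗ[K] V}
    (h : ∀ t : Monomial G X, n ≤ t.1.length → f (Finsupp.single t 1) = g (Finsupp.single t 1)) :
    Set.EqOn f g (longMonomials K G X n) := by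
  rw [longMonomials_eq_span]
  refine LinearMap.eqOn_span ?_
  rintro _ ⟨t, ht, rfl⟩
  exact h t ht

end LongMonomials

section Representation

variable (K : Type*) [Field K] {G X : Type*} [Group G] [MulAction G (List X)]
  [SelfSimilarGroup G X]

open scoped Classical in
/-- Left multiplication of monomials by the generators of the Nekrashevych algebra. The product of
`x^*` and a monomial `g` without letters is not a combination of monomials; it is set to `0`, so
that the defining relations are only valid on monomials with sufficiently many letters. -/
noncomputable def generatorAction : NekGen G X → Module.End K (Monomial G X →₀ K)
  | .letter x => Finsupp.lmapDomain K K fun t => (x :: t.1, t.2)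
  | .elt g => Finsupp.lmapDomain K K fun t => (g • t.1, sectWord g t.1 * t.2)
  | .letterStar x => Finsupp.linearCombination K fun t : Monomial G X =>
      match t with
      | ([], _) => 0
      | (y :: u, g) => if y = x then Finsupp.single (u, g) 1 else 0

variable (G X) in
/-- The action of the free algebra on combinations of monomials that extends `generatorAction`. -/
noncomputable def monomialRep :
    FreeAlgebra K (NekGen G X) →ₐ[K] Module.End K (Monomial G X →₀ K) :=
  FreeAlgebra.lift K (generatorAction K)

theorem monomialRep_gX (x : X) (t : Monomial G X) :
    monomialRep K G X (gX K G x) (Finsupp.single t 1) = Finsupp.single (x :: t.1, t.2) 1 := by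
  simp [monomialRep, gX, generatorAction, Finsupp.mapDomain_single]

theorem monomialRep_gG (g : G) (t : Monomial G X) :
    monomialRep K G X (gG K X g) (Finsupp.single t 1) =
      Finsupp.single (g • t.1, sectWord g t.1 * t.2) 1 := by
  simp [monomialRep, gG, generatorAction, Finsupp.mapDomain_single]

theorem monomialRep_gXs_cons_self (x : X) (u : List X) (g : G) :
    monomialRep K G X (gXs K G x) (Finsupp.single (x :: u, g) 1) = Finsupp.single (u, g) 1 := by
  simp [monomialRep, gXs, generatorAction]

theorem monomialRep_gXs_cons_of_ne {x y : X} (h : y ≠ x) (u : List X) (g : G) :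
    monomialRep K G X (gXs K G x) (Finsupp.single (y :: u, g) 1) = 0 := by
  simp [monomialRep, gXs, generatorAction, h]

theorem monomialRep_prod_gX (u : List X) (t : Monomial G X) :
    monomialRep K G X (u.map (gX K G)).prod (Finsupp.single t 1) =
      Finsupp.single (u ++ t.1, t.2) 1 := by
  induction u with
  | nil => simp
  | cons x u ih => simp [ih, monomialRep_gX]

/-- The element of the free algebra that is represented by a combination of monomials. -/
noncomputable def toFreeAlgebra : (Monomial G X →₀ K) →ₗ[K] FreeAlgebra K (NekGen G X) :=
  Finsupp.linearCombination K fun t => (t.1.map (gX K G)).prod * gG K X t.2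

theorem monomialRep_toFreeAlgebra (φ : Monomial G X →₀ K) (w : List X) :
    monomialRep K G X (toFreeAlgebra K φ) (Finsupp.single (w, 1) 1) = φ.mapDomain (mulWord w) := by
  induction φ using Finsupp.induction_linear with
  | zero => simp
  | add f g hf hg => rw [map_add, map_add, LinearMap.add_apply, hf, hg, Finsupp.mapDomain_add]
  | single t c =>
    simp [toFreeAlgebra, Finsupp.linearCombination_single, monomialRep_gG, monomialRep_prod_gX,
      Finsupp.mapDomain_single, mulWord]

variable {K} [Fintype X]

theorem monomialRep_eq_of_nekRel {a b : FreeAlgebra K (NekGen G X)} (h : NekRel K G X a b) :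
    Set.EqOn (monomialRep K G X a) (monomialRep K G X b) (longMonomials K G X 1) := by
  refine eqOn_longMonomials ?_
  rintro ⟨u, k⟩ ht
  obtain ⟨y, u, rfl⟩ := List.exists_cons_of_length_pos ht
  cases h with
  | one => simp [monomialRep_gG, sectWord_one]
  | mul g h => simp [monomialRep_gG, sectWord_mul, mul_smul, mul_assoc]
  | ss g x => simp [monomialRep_gG, monomialRep_gX, smul_cons, sectWord]
  | ss_star g x =>
    obtain ⟨z, rfl⟩ : ∃ z, y = letter g z :=
      ⟨letter g⁻¹ y, by simpa only [inv_inv] using (letter_inv g⁻¹ y).symm⟩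
    rcases eq_or_ne z x with rfl | hz
    · simp [monomialRep_gG, monomialRep_gXs_cons_self, smul_cons, sectWord, letter_inv, sect_inv]
    · have : letter g z ≠ letter g x := fun h => hz (by rw [← letter_inv g z, h, letter_inv])
      simp [monomialRep_gG, smul_cons, letter_inv, monomialRep_gXs_cons_of_ne K hz,
        monomialRep_gXs_cons_of_ne K this]
  | ck1_same x => simp [monomialRep_gX, monomialRep_gXs_cons_self]
  | ck1_ne x z hxz => simp [monomialRep_gX, monomialRep_gXs_cons_of_ne K hxz]
  | ck2 =>
    simp only [map_sum, map_mul, LinearMap.sum_apply, Module.End.mul_apply, map_one,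
      Module.End.one_apply]
    rw [Finset.sum_eq_single_of_mem y (Finset.mem_univ y)]
    · simp [monomialRep_gX, monomialRep_gXs_cons_self]
    · intro x _ hx
      rw [monomialRep_gXs_cons_of_ne K hx.symm, map_zero]

variable (K)

variable (G) in
/-- The letter `x` in the Nekrashevych algebra. -/
noncomputable def mkLetter (x : X) : NekrashevychAlgebra K G X :=
  RingQuot.mkAlgHom K (NekRel K G X) (gX K G x)

variable (G) in
/-- The adjoint `x^*` in the Nekrashevych algebra. -/
noncomputable def mkLetterStar (x : X) : NekrashevychAlgebra K G X :=
  RingQuot.mkAlgHom K (NekRel K G X) (gXs K G x)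

variable (X) in
/-- The group element `g` in the Nekrashevych algebra. -/
noncomputable def mkElt (g : G) : NekrashevychAlgebra K G X :=
  RingQuot.mkAlgHom K (NekRel K G X) (gG K X g)

variable (G) in
/-- The word `w`, as a product of letters, in the Nekrashevych algebra. -/
noncomputable def mkWord (w : List X) : NekrashevychAlgebra K G X := (w.map (mkLetter K G)).prod

variable (G) in
/-- The adjoint `w^*` of a word in the Nekrashevych algebra. -/
noncomputable def mkWordStar (w : List X) : NekrashevychAlgebra K G X :=
  (w.reverse.map (mkLetterStar K G)).prod

theorem mkElt_one : mkElt K X (1 : G) = 1 := by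
  rw [mkElt, RingQuot.mkAlgHom_rel K NekRel.one, map_one]

theorem mkElt_mul (g h : G) : mkElt K X (g * h) = mkElt K X g * mkElt K X h := by
  rw [mkElt, mkElt, mkElt, ← map_mul, RingQuot.mkAlgHom_rel K (NekRel.mul g h)]

theorem mkElt_mul_mkElt_inv (g : G) : mkElt K X g * mkElt K X g⁻¹ = 1 := by
  rw [← mkElt_mul, mul_inv_cancel, mkElt_one]

theorem mkElt_mul_mkLetter (g : G) (x : X) :
    mkElt K X g * mkLetter K G x = mkLetter K G (letter g x) * mkElt K X (sect g x) := by
  simp only [mkElt, mkLetter, ← map_mul]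
  exact RingQuot.mkAlgHom_rel K (NekRel.ss g x)

theorem mkLetterStar_mul_mkLetter_self (x : X) : mkLetterStar K G x * mkLetter K G x = 1 := by
  rw [mkLetterStar, mkLetter, ← map_mul, RingQuot.mkAlgHom_rel K (NekRel.ck1_same x), map_one]

theorem mkLetterStar_mul_mkLetter_of_ne {x y : X} (h : x ≠ y) :
    mkLetterStar K G y * mkLetter K G x = 0 := by
  rw [mkLetterStar, mkLetter, ← map_mul, RingQuot.mkAlgHom_rel K (NekRel.ck1_ne x y h), map_zero]

theorem sum_mkLetter_mul_mkLetterStar : ∑ x : X, mkLetter K G x * mkLetterStar K G x = 1 := by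
  simp only [mkLetterStar, mkLetter, ← map_mul, ← map_sum]
  rw [RingQuot.mkAlgHom_rel K NekRel.ck2, map_one]

theorem mkWord_nil : mkWord K G ([] : List X) = 1 := rfl

theorem mkWord_cons (x : X) (w : List X) :
    mkWord K G (x :: w) = mkLetter K G x * mkWord K G w := by
  simp [mkWord]

theorem mkWord_append (v w : List X) :
    mkWord K G (v ++ w) = mkWord K G v * mkWord K G w := by
  simp [mkWord]

theorem mkWordStar_nil : mkWordStar K G ([] : List X) = 1 := rfl

theorem mkWordStar_cons (x : X) (w : List X) :
    mkWordStar K G (x :: w) = mkWordStar K G w * mkLetterStar K G x := by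
  simp [mkWordStar]

theorem mkElt_mul_mkWord (g : G) (w : List X) :
    mkElt K X g * mkWord K G w = mkWord K G (g • w) * mkElt K X (sectWord g w) := by
  induction w generalizing g with
  | nil => simp [mkWord_nil, smul_nil, sectWord]
  | cons x w ih =>
    rw [mkWord_cons, ← mul_assoc, mkElt_mul_mkLetter, mul_assoc, ih, smul_cons, mkWord_cons,
      mul_assoc, sectWord]

theorem mkWordStar_mul_mkWord_self (w : List X) : mkWordStar K G w * mkWord K G w = 1 := by
  induction w with
  | nil => rw [mkWord_nil, mkWordStar_nil, mul_one]
  | cons x w ih =>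
    rw [mkWordStar_cons, mkWord_cons, mul_assoc, ← mul_assoc (mkLetterStar K G x),
      mkLetterStar_mul_mkLetter_self, one_mul, ih]

theorem mkWordStar_mul_mkWord_of_incomparable {u v : List X} (h : Incomparable u v) :
    mkWordStar K G u * mkWord K G v = 0 := by
  induction u generalizing v with
  | nil => exact absurd ⟨_, rfl⟩ h.1
  | cons x u ih =>
    cases v with
    | nil => exact absurd ⟨_, rfl⟩ h.2
    | cons y v =>
      rw [mkWordStar_cons, mkWord_cons, mul_assoc, ← mul_assoc (mkLetterStar K G x)]
      rcases eq_or_ne y x with rfl | hyx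
      · rw [mkLetterStar_mul_mkLetter_self, one_mul]
        exact ih ⟨fun h' => h.1 (by simpa using h'), fun h' => h.2 (by simpa using h')⟩
      · rw [mkLetterStar_mul_mkLetter_of_ne K hyx, zero_mul, mul_zero]

theorem eq_zero_of_forall_mul_mkWord {a : NekrashevychAlgebra K G X} (n : ℕ)
    (h : ∀ w : List X, w.length = n → a * mkWord K G w = 0) : a = 0 := by
  induction n generalizing a with
  | zero => simpa [mkWord_nil] using h [] rfl
  | succ n ih =>
    have hletter (x : X) : a * mkLetter K G x = 0 := ih fun w hw => by
      rw [mul_assoc, ← mkWord_cons]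
      exact h _ (by simp [hw])
    rw [← mul_one a, ← sum_mkLetter_mul_mkLetterStar K (G := G) (X := X), Finset.mul_sum]
    exact Finset.sum_eq_zero fun x _ => by rw [← mul_assoc, hletter, zero_mul]

/-- The element of the Nekrashevych algebra that is represented by a combination of monomials. -/
noncomputable def toAlgebra : (Monomial G X →₀ K) →ₗ[K] NekrashevychAlgebra K G X :=
  Finsupp.linearCombination K fun t => mkWord K G t.1 * mkElt K X t.2

theorem toAlgebra_single (t : Monomial G X) (c : K) :
    toAlgebra K (Finsupp.single t c) = c • (mkWord K G t.1 * mkElt K X t.2) :=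
  Finsupp.linearCombination_single K c t

theorem toAlgebra_single_one (w : List X) :
    toAlgebra K (Finsupp.single (w, (1 : G)) 1) = mkWord K G w := by
  rw [toAlgebra_single, one_smul, mkElt_one, mul_one]

theorem toAlgebra_mul_mkWord (φ : Monomial G X →₀ K) (w : List X) :
    toAlgebra K φ * mkWord K G w = toAlgebra K (φ.mapDomain (mulWord w)) := by
  induction φ using Finsupp.induction_linear with
  | zero => simp
  | add f g hf hg => rw [map_add, add_mul, hf, hg, Finsupp.mapDomain_add, map_add]
  | single t c =>
    rw [Finsupp.mapDomain_single, toAlgebra_single, toAlgebra_single, mulWord, mkWord_append,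
      smul_mul_assoc, mul_assoc, mkElt_mul_mkWord, mul_assoc]

variable {K}

/-- The element `a` of the free algebra removes at most `c` letters from every monomial `t` with at
least `c` letters, and acts on `t` as its image in the Nekrashevych algebra does. -/
def HasDelay (a : FreeAlgebra K (NekGen G X)) (c : ℕ) : Prop :=
  ∀ n, ∀ φ ∈ longMonomials K G X (n + c), monomialRep K G X a φ ∈ longMonomials K G X n ∧
    RingQuot.mkAlgHom K (NekRel K G X) a * toAlgebra K φ = toAlgebra K (monomialRep K G X a φ)

theorem hasDelay_of_forall_single {a : FreeAlgebra K (NekGen G X)} {c : ℕ}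
    (h : ∀ n, ∀ t : Monomial G X, n + c ≤ t.1.length →
      monomialRep K G X a (Finsupp.single t 1) ∈ longMonomials K G X n ∧
      RingQuot.mkAlgHom K (NekRel K G X) a * (mkWord K G t.1 * mkElt K X t.2) =
        toAlgebra K (monomialRep K G X a (Finsupp.single t 1))) : HasDelay a c := by
  refine fun n φ hφ => ⟨longMonomials_le_comap (fun t ht => (h n t ht).1) hφ, ?_⟩
  refine eqOn_longMonomials (n := n + c)
    (f := LinearMap.mulLeft K (RingQuot.mkAlgHom K (NekRel K G X) a) ∘ₗ toAlgebra K)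
    (g := toAlgebra K ∘ₗ monomialRep K G X a) (fun t ht => ?_) hφ
  simpa [toAlgebra_single] using (h n t ht).2

theorem hasDelay_gX (x : X) : HasDelay (gX K G x) 0 :=
  hasDelay_of_forall_single fun n t ht => by
    rw [monomialRep_gX, toAlgebra_single, one_smul, mkWord_cons, mul_assoc]
    exact ⟨single_mem_longMonomials (ht.trans (Nat.le_succ _)), rfl⟩

theorem hasDelay_gG (g : G) : HasDelay (gG K X g) 0 :=
  hasDelay_of_forall_single fun n t ht => by
    rw [monomialRep_gG, toAlgebra_single, one_smul, mkElt_mul, ← mul_assoc, ← mul_assoc,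
      ← mkElt_mul_mkWord]
    exact ⟨single_mem_longMonomials (by simpa [length_smul] using ht), rfl⟩

theorem hasDelay_gXs (x : X) : HasDelay (gXs K G x) 1 := by
  refine hasDelay_of_forall_single fun n t ht => ?_
  obtain ⟨u, g⟩ := t
  obtain ⟨y, u, rfl⟩ := List.exists_cons_of_length_pos (Nat.lt_of_lt_of_le n.succ_pos ht)
  rw [mkWord_cons, ← mul_assoc, ← mul_assoc, ← mkLetterStar]
  rcases eq_or_ne y x with rfl | hy
  · rw [monomialRep_gXs_cons_self, toAlgebra_single, one_smul, mkLetterStar_mul_mkLetter_self,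
      one_mul]
    exact ⟨single_mem_longMonomials (by simpa using ht), rfl⟩
  · rw [monomialRep_gXs_cons_of_ne K hy, mkLetterStar_mul_mkLetter_of_ne K hy, zero_mul, zero_mul,
      map_zero]
    exact ⟨Submodule.zero_mem _, rfl⟩

theorem hasDelay_algebraMap (r : K) :
    HasDelay (algebraMap K (FreeAlgebra K (NekGen G X)) r) 0 := fun n φ hφ => by
  simp only [Algebra.algebraMap_eq_smul_one, smul_mul_assoc, one_mul, map_one,
    LinearMap.smul_apply, Module.End.one_apply, map_smul, and_true]
  exact Submodule.smul_mem _ r hφ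

theorem HasDelay.mono {a : FreeAlgebra K (NekGen G X)} {c c' : ℕ} (h : HasDelay a c)
    (hc : c ≤ c') : HasDelay a c' :=
  fun n φ hφ => h n φ (longMonomials_anti (Nat.add_le_add_left hc n) hφ)

theorem HasDelay.add {a b : FreeAlgebra K (NekGen G X)} {c : ℕ} (ha : HasDelay a c)
    (hb : HasDelay b c) : HasDelay (a + b) c := fun n φ hφ => by
  simp only [map_add, LinearMap.add_apply, add_mul, (ha n φ hφ).2, (hb n φ hφ).2, and_true]
  exact Submodule.add_mem _ (ha n φ hφ).1 (hb n φ hφ).1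

theorem HasDelay.mul {a b : FreeAlgebra K (NekGen G X)} {c e : ℕ} (ha : HasDelay a c)
    (hb : HasDelay b e) : HasDelay (a * b) (c + e) := fun n φ hφ => by
  obtain ⟨hmem, heq⟩ := hb (n + c) φ (by rwa [add_assoc])
  simp only [map_mul, Module.End.mul_apply, mul_assoc, heq, (ha n _ hmem).2, and_true]
  exact (ha n _ hmem).1

theorem exists_hasDelay (a : FreeAlgebra K (NekGen G X)) : ∃ c, HasDelay a c := by
  induction a with
  | grade0 r => exact ⟨0, hasDelay_algebraMap r⟩
  | grade1 s =>
    cases s with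
    | letter x => exact ⟨0, hasDelay_gX x⟩
    | letterStar x => exact ⟨1, hasDelay_gXs x⟩
    | elt g => exact ⟨0, hasDelay_gG g⟩
  | mul a b ha hb =>
    obtain ⟨⟨c, hc⟩, e, he⟩ := And.intro ha hb
    exact ⟨c + e, hc.mul he⟩
  | add a b ha hb =>
    obtain ⟨⟨c, hc⟩, e, he⟩ := And.intro ha hb
    exact ⟨max c e, (hc.mono (le_max_left c e)).add (he.mono (le_max_right c e))⟩

variable (K G X) in
/-- The ideal of the elements of the free algebra that annihilate all sufficiently long
monomials. -/
def longAnnihilator : TwoSidedIdeal (FreeAlgebra K (NekGen G X)) :=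
  .mk' {a | ∃ n, ∀ φ ∈ longMonomials K G X n, monomialRep K G X a φ = 0}
    ⟨0, by simp⟩
    (fun {a b} ⟨n, hn⟩ ⟨m, hm⟩ => ⟨max n m, fun φ hφ => by
      rw [map_add, LinearMap.add_apply, hn φ (longMonomials_anti (le_max_left n m) hφ),
        hm φ (longMonomials_anti (le_max_right n m) hφ), add_zero]⟩)
    (fun {a} ⟨n, hn⟩ => ⟨n, fun φ hφ => by rw [map_neg, LinearMap.neg_apply, hn φ hφ, neg_zero]⟩)
    (fun {a b} ⟨n, hn⟩ => ⟨n, fun φ hφ => by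
      rw [map_mul, Module.End.mul_apply, hn φ hφ, map_zero]⟩)
    (fun {a b} ⟨n, hn⟩ => by
      obtain ⟨c, hc⟩ := exists_hasDelay b
      exact ⟨n + c, fun φ hφ => by
        rw [map_mul, Module.End.mul_apply, hn _ (hc n φ hφ).1]⟩)

theorem mem_longAnnihilator {a : FreeAlgebra K (NekGen G X)} : a ∈ longAnnihilator K G X ↔
    ∃ n, ∀ φ ∈ longMonomials K G X n, monomialRep K G X a φ = 0 :=
  TwoSidedIdeal.mem_mk' _ _ _ _ _ _ a

theorem mem_longAnnihilator_of_mkAlgHom_eq_zero {a : FreeAlgebra K (NekGen G X)}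
    (ha : RingQuot.mkAlgHom K (NekRel K G X) a = 0) : a ∈ longAnnihilator K G X := by
  have hrel ⦃a b⦄ (h : NekRel K G X a b) :
      (longAnnihilator K G X).ringCon.mk' a = (longAnnihilator K G X).ringCon.mk' b := by
    refine (RingCon.eq _).mpr ?_
    rw [TwoSidedIdeal.rel_iff, mem_longAnnihilator]
    exact ⟨1, fun φ hφ => by
      rw [map_sub, LinearMap.sub_apply, monomialRep_eq_of_nekRel h hφ, sub_self]⟩
  have hmk : (longAnnihilator K G X).ringCon.mk' a = 0 := by
    rw [← RingQuot.lift_mkRingHom_apply _ hrel a, ← RingQuot.mkAlgHom_coe K, AlgHom.coe_toRingHom,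
      ha, map_zero]
  have h0 : (longAnnihilator K G X).ringCon a 0 := (RingCon.eq _).mp hmk
  rwa [TwoSidedIdeal.rel_iff, sub_zero] at h0

theorem mkAlgHom_toFreeAlgebra (φ : Monomial G X →₀ K) :
    RingQuot.mkAlgHom K (NekRel K G X) (toFreeAlgebra K φ) = toAlgebra K φ := by
  induction φ using Finsupp.induction_linear with
  | zero => simp
  | add f g hf hg => rw [map_add, map_add, hf, hg, map_add]
  | single t c =>
    simp only [toFreeAlgebra, Finsupp.linearCombination_single, map_smul, toAlgebra_single, map_mul,
      map_list_prod, List.map_map]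
    rfl

theorem toAlgebra_eq_zero_iff {φ : Monomial G X →₀ K} : toAlgebra K φ = 0 ↔ IsNull φ := by
  constructor
  · intro h
    obtain ⟨n, hn⟩ := mem_longAnnihilator.mp
      (mem_longAnnihilator_of_mkAlgHom_eq_zero ((mkAlgHom_toFreeAlgebra φ).trans h))
    refine ⟨n, fun w hw => ?_⟩
    rw [← monomialRep_toFreeAlgebra]
    exact hn _ (single_mem_longMonomials hw.ge)
  · rintro ⟨n, hn⟩
    refine eq_zero_of_forall_mul_mkWord K n fun w hw => ?_
    rw [toAlgebra_mul_mkWord, hn w hw, map_zero]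

end Representation

section Simplicity

variable (K : Type*) [Field K] {G X : Type*} [Fintype X] [Group G]
  [MulAction G (List X)] [SelfSimilarGroup G X]

variable {K} in
theorem exists_mul_mkWord_eq_toAlgebra (a : NekrashevychAlgebra K G X) :
    ∃ c, ∀ v : List X, c ≤ v.length →
      ∃ φ : Monomial G X →₀ K, a * mkWord K G v = toAlgebra K φ := by
  obtain ⟨a, rfl⟩ := RingQuot.mkAlgHom_surjective K (NekRel K G X) a
  obtain ⟨c, hc⟩ := exists_hasDelay a
  refine ⟨c, fun v hv => ⟨monomialRep K G X a (Finsupp.single (v, 1) 1), ?_⟩⟩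
  rw [← (hc 0 _ (single_mem_longMonomials (by simpa using hv))).2, toAlgebra_single_one]

theorem mkWordStar_mul_toAlgebra {φ : Monomial G X →₀ K}
    (h : ∀ t ∈ φ.support, ∀ t' ∈ φ.support, t = t' ∨ Incomparable t.1 t'.1) {t : Monomial G X}
    (ht : t ∈ φ.support) : mkWordStar K G t.1 * toAlgebra K φ = φ t • mkElt K X t.2 := by
  rw [toAlgebra, Finsupp.linearCombination_apply, Finsupp.sum, Finset.mul_sum,
    Finset.sum_eq_single_of_mem t ht]
  · rw [mul_smul_comm, ← mul_assoc, mkWordStar_mul_mkWord_self, one_mul]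
  · intro t' ht' hne
    have hinc := (h t ht t' ht').resolve_left hne.symm
    rw [mul_smul_comm, ← mul_assoc, mkWordStar_mul_mkWord_of_incomparable K hinc, zero_mul,
      smul_zero]

theorem mkWordStar_mul_toAlgebra_mul_mkElt {φ : Monomial G X →₀ K}
    (h : ∀ t ∈ φ.support, ∀ t' ∈ φ.support, t = t' ∨ Incomparable t.1 t'.1) {t : Monomial G X}
    (ht : t ∈ φ.support) :
    mkWordStar K G t.1 * toAlgebra K φ * ((φ t)⁻¹ • mkElt K X t.2⁻¹) = 1 := by
  rw [mkWordStar_mul_toAlgebra K h ht, smul_mul_smul_comm,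
    mul_inv_cancel₀ (Finsupp.mem_support_iff.mp ht), mkElt_mul_mkElt_inv, one_smul]

theorem mul_mkWord_append_eq_zero {a : NekrashevychAlgebra K G X} {v : List X}
    (h : a * mkWord K G v = 0) (w : List X) : a * mkWord K G (v ++ w) = 0 := by
  rw [mkWord_append, ← mul_assoc, h, zero_mul]

theorem exists_mul_toAlgebra_mul_mkWord_eq_zero {a : NekrashevychAlgebra K G X}
    (ha : ∀ v : List X, ∃ w, a * mkWord K G (v ++ w) = 0) (φ : Monomial G X →₀ K) (v : List X) :
    ∃ w, a * toAlgebra K φ * mkWord K G (v ++ w) = 0 := by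
  induction φ using Finsupp.induction_linear generalizing v with
  | zero => exact ⟨[], by simp⟩
  | add f g hf hg =>
    obtain ⟨w, hw⟩ := hf v
    obtain ⟨z, hz⟩ := hg (v ++ w)
    refine ⟨w ++ z, ?_⟩
    rw [map_add, mul_add, add_mul, ← List.append_assoc, hz, mul_mkWord_append_eq_zero K hw,
      add_zero]
  | single t c =>
    obtain ⟨u, g⟩ := t
    obtain ⟨z, hz⟩ := ha (u ++ g • v)
    refine ⟨(sectWord g v)⁻¹ • z, ?_⟩
    rw [mul_assoc, toAlgebra_mul_mkWord, Finsupp.mapDomain_single, toAlgebra_single, mulWord,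
      smul_append, smul_inv_smul, ← List.append_assoc, mul_smul_comm, ← mul_assoc, hz, zero_mul,
      smul_zero]

variable [Nontrivial X]

theorem nontrivial_nekrashevychAlgebra : Nontrivial (NekrashevychAlgebra K G X) := by
  refine nontrivial_of_ne 1 0 fun h => ?_
  have hnull : IsNull (Finsupp.single (([] : List X), (1 : G)) (1 : K)) := by
    rw [← toAlgebra_eq_zero_iff, toAlgebra_single_one, mkWord_nil, h]
  obtain ⟨n, hn⟩ := hnull
  have := hn (List.replicate n (Classical.arbitrary X)) List.length_replicate
  rw [Finsupp.mapDomain_single, Finsupp.single_eq_zero] at this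
  exact one_ne_zero this

variable (G X) in
/-- The ideal of the elements `a` such that every word extends to a word `w` with `a w = 0`. -/
def singularIdeal : TwoSidedIdeal (NekrashevychAlgebra K G X) :=
  .mk' {a | ∀ v : List X, ∃ w, a * mkWord K G (v ++ w) = 0}
    (fun v => ⟨[], zero_mul _⟩)
    (fun {a b} ha hb v => by
      obtain ⟨w, hw⟩ := ha v
      obtain ⟨z, hz⟩ := hb (v ++ w)
      refine ⟨w ++ z, ?_⟩
      rw [← List.append_assoc, add_mul, hz, mul_mkWord_append_eq_zero K hw, add_zero])
    (fun {a} ha v => by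
      obtain ⟨w, hw⟩ := ha v
      exact ⟨w, (neg_mul a _).trans (by rw [hw]; exact neg_zero)⟩)
    (fun {a b} hb v => by
      obtain ⟨w, hw⟩ := hb v
      exact ⟨w, by rw [mul_assoc, hw, mul_zero]⟩)
    (fun {a b} ha v => by
      obtain ⟨c, hc⟩ := exists_mul_mkWord_eq_toAlgebra b
      obtain ⟨φ, hφ⟩ := hc (v ++ List.replicate c (Classical.arbitrary X)) (by simp)
      obtain ⟨w, hw⟩ := exists_mul_toAlgebra_mul_mkWord_eq_zero K ha φ []
      refine ⟨List.replicate c (Classical.arbitrary X) ++ w, ?_⟩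
      rwa [← List.append_assoc, mkWord_append, mul_assoc, ← mul_assoc b, hφ, ← mul_assoc])

theorem mem_singularIdeal {a : NekrashevychAlgebra K G X} :
    a ∈ singularIdeal K G X ↔ ∀ v : List X, ∃ w, a * mkWord K G (v ++ w) = 0 :=
  TwoSidedIdeal.mem_mk' _ _ _ _ _ _ a

theorem singularIdeal_ne_top : singularIdeal K G X ≠ ⊤ := by
  have := nontrivial_nekrashevychAlgebra K (G := G) (X := X)
  rw [Ne, ← TwoSidedIdeal.one_mem_iff, mem_singularIdeal]
  intro h
  obtain ⟨w, hw⟩ := h []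
  rw [List.nil_append] at hw
  refine zero_ne_one (α := NekrashevychAlgebra K G X) ?_
  rw [← mkWordStar_mul_mkWord_self K w, ← one_mul (mkWord K G w), hw, mul_zero]

theorem eq_top_of_notMem_singularIdeal {I : TwoSidedIdeal (NekrashevychAlgebra K G X)}
    {a : NekrashevychAlgebra K G X} (ha : a ∈ I) (hsing : a ∉ singularIdeal K G X) : I = ⊤ := by
  simp only [mem_singularIdeal, not_forall, not_exists] at hsing
  obtain ⟨v, hv⟩ := hsing
  obtain ⟨c, hc⟩ := exists_mul_mkWord_eq_toAlgebra a
  obtain ⟨φ, hφ⟩ := hc (v ++ List.replicate c (Classical.arbitrary X)) (by simp)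
  obtain ⟨w, hw⟩ := exists_forall_support_eq_or_incomparable φ []
  rw [List.nil_append] at hw
  have haw : a * mkWord K G (v ++ List.replicate c (Classical.arbitrary X) ++ w) =
      toAlgebra K (φ.mapDomain (mulWord w)) := by
    rw [mkWord_append, ← mul_assoc, hφ, toAlgebra_mul_mkWord]
  obtain ⟨t, ht⟩ : (φ.mapDomain (mulWord w)).support.Nonempty := by
    rw [Finsupp.support_nonempty_iff]
    rintro h
    rw [h, map_zero, List.append_assoc] at haw
    exact hv _ haw
  rw [← TwoSidedIdeal.one_mem_iff, ← mkWordStar_mul_toAlgebra_mul_mkElt K hw ht, ← haw]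
  exact I.mul_mem_right _ _ (I.mul_mem_left _ _ (I.mul_mem_right _ _ ha))

theorem toAlgebra_mem_singularIdeal_iff {φ : Monomial G X →₀ K} :
    toAlgebra K φ ∈ singularIdeal K G X ↔ IsSingular φ := by
  rw [mem_singularIdeal]
  constructor
  · intro h v
    obtain ⟨w, hw⟩ := h v
    obtain ⟨z, hz⟩ := exists_forall_support_eq_or_incomparable φ (v ++ w)
    have h0 := mul_mkWord_append_eq_zero K hw z
    rw [toAlgebra_mul_mkWord] at h0
    refine ⟨w ++ z, ?_⟩
    rw [← List.append_assoc]
    by_contra hne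
    obtain ⟨t, ht⟩ := Finsupp.support_nonempty_iff.mpr hne
    have := nontrivial_nekrashevychAlgebra K (G := G) (X := X)
    refine zero_ne_one (α := NekrashevychAlgebra K G X) ?_
    rw [← mkWordStar_mul_toAlgebra_mul_mkElt K hz ht, h0, mul_zero, zero_mul]
  · intro h v
    obtain ⟨w, hw⟩ := h v
    exact ⟨w, by rw [toAlgebra_mul_mkWord, hw, map_zero]⟩

theorem singularIdeal_eq_bot_iff : singularIdeal K G X = ⊥ ↔ NoSingular G X K := by
  constructor
  · intro h φ hφ
    rwa [← toAlgebra_mem_singularIdeal_iff, h, TwoSidedIdeal.mem_bot, toAlgebra_eq_zero_iff] at hφ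
  · intro h
    refine le_bot_iff.mp fun a ha => (TwoSidedIdeal.mem_bot _).mpr ?_
    obtain ⟨c, hc⟩ := exists_mul_mkWord_eq_toAlgebra a
    refine eq_zero_of_forall_mul_mkWord K c fun v hv => ?_
    obtain ⟨φ, hφ⟩ := hc v hv.ge
    rw [hφ, toAlgebra_eq_zero_iff]
    refine h φ ((toAlgebra_mem_singularIdeal_iff K).mp ?_)
    rw [← hφ]
    exact (singularIdeal K G X).mul_mem_right _ _ ha

theorem isSimpleRing_iff_noSingular :
    IsSimpleRing (NekrashevychAlgebra K G X) ↔ NoSingular G X K := by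
  have := nontrivial_nekrashevychAlgebra K (G := G) (X := X)
  rw [← singularIdeal_eq_bot_iff]
  constructor
  · intro hs
    exact (hs.simple.eq_bot_or_eq_top (singularIdeal K G X)).resolve_right (singularIdeal_ne_top K)
  · intro h
    refine ⟨⟨fun I => or_iff_not_imp_left.mpr fun hI => ?_⟩⟩
    obtain ⟨a, haI, ha⟩ := SetLike.not_le_iff_exists.mp (mt le_bot_iff.mp hI)
    exact eq_top_of_notMem_singularIdeal K haI (h ▸ ha)

end Simplicity

section Coefficients

variable {G X : Type*} [Group G] [MulAction G (List X)] [SelfSimilarGroup G X]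
  {M M' : Type*} [AddCommMonoid M] [AddCommMonoid M']

theorem IsSingular.mapRange (j : M →+ M') {φ : Monomial G X →₀ M} (h : IsSingular φ) :
    IsSingular (φ.mapRange j j.map_zero) := fun v => by
  obtain ⟨w, hw⟩ := h v
  exact ⟨w, by rw [Finsupp.mapDomain_mapRange _ _ _ _ j.map_add, hw, Finsupp.mapRange_zero]⟩

theorem IsNull.mapRange (j : M →+ M') {φ : Monomial G X →₀ M} (h : IsNull φ) :
    IsNull (φ.mapRange j j.map_zero) := by
  obtain ⟨n, hn⟩ := h
  exact ⟨n, fun w hw => by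
    rw [Finsupp.mapDomain_mapRange _ _ _ _ j.map_add, hn w hw, Finsupp.mapRange_zero]⟩

theorem isSingular_mapRange_iff {j : M →+ M'} (hj : Function.Injective j)
    {φ : Monomial G X →₀ M} : IsSingular (φ.mapRange j j.map_zero) ↔ IsSingular φ := by
  refine ⟨fun h v => ?_, fun h => h.mapRange j⟩
  obtain ⟨w, hw⟩ := h v
  refine ⟨w, Finsupp.mapRange_injective j j.map_zero hj ?_⟩
  rw [← Finsupp.mapDomain_mapRange _ _ _ _ j.map_add, hw, Finsupp.mapRange_zero]

theorem isNull_mapRange_iff {j : M →+ M'} (hj : Function.Injective j) {φ : Monomial G X →₀ M} :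
    IsNull (φ.mapRange j j.map_zero) ↔ IsNull φ := by
  refine ⟨fun ⟨n, hn⟩ => ⟨n, fun w hw => ?_⟩, fun h => h.mapRange j⟩
  refine Finsupp.mapRange_injective j j.map_zero hj ?_
  rw [← Finsupp.mapDomain_mapRange _ _ _ _ j.map_add, hn w hw, Finsupp.mapRange_zero]

theorem NoSingular.of_injective (h : NoSingular G X M') {j : M →+ M'}
    (hj : Function.Injective j) : NoSingular G X M := fun _ hφ =>
  (isNull_mapRange_iff hj).mp (h _ (hφ.mapRange j))

theorem NoSingular.pi {ι : Type*} [Finite ι] (h : NoSingular G X M) :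
    NoSingular G X (ι → M) := fun φ hφ => by
  have := Fintype.ofFinite ι
  choose n hn using fun i => h _ (hφ.mapRange (Pi.evalAddMonoidHom (fun _ : ι => M) i))
  refine ⟨Finset.univ.sup n, fun w hw => ?_⟩
  ext t i
  have := mapDomain_mulWord_eq_zero_of_le (hn i) w (by
    rw [hw]; exact Finset.le_sup (Finset.mem_univ i))
  rw [Finsupp.mapDomain_mapRange _ _ _ _ (map_add _)] at this
  simpa using DFunLike.congr_fun this t

theorem NoSingular.of_forall_fg {R V : Type*} [CommRing R] [AddCommGroup V] [Module R V]
    (hfree : ∀ p : Submodule R V, p.FG → Module.Free R p) (h : NoSingular G X R) :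
    NoSingular G X V := by
  intro φ hφ
  let p : Submodule R V := Submodule.span R (φ '' φ.support)
  have hfg : p.FG := Submodule.fg_span (φ.support.finite_toSet.image _)
  have := hfree p hfg
  have : Module.Finite R p := Module.Finite.iff_fg.mpr hfg
  have hmem (t : Monomial G X) : φ t ∈ p := by
    by_cases ht : t ∈ φ.support
    · exact Submodule.subset_span ⟨t, ht, rfl⟩
    · rw [Finsupp.notMem_support_iff.mp ht]
      exact p.zero_mem
  let ψ : Monomial G X →₀ p := Finsupp.onFinset φ.support (fun t => ⟨φ t, hmem t⟩) fun t ht => by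
    rw [Finsupp.mem_support_iff]
    exact fun h0 => ht (Subtype.ext h0)
  have hψ : ψ.mapRange p.subtype.toAddMonoidHom (map_zero _) = φ := Finsupp.ext fun _ => rfl
  have hinj : Function.Injective p.subtype.toAddMonoidHom := p.injective_subtype
  have hp : NoSingular G X p := (h.pi (ι := Module.Free.ChooseBasisIndex R p)).of_injective
    (j := (Module.Free.chooseBasis R p).equivFun.toLinearMap.toAddMonoidHom)
    (Module.Free.chooseBasis R p).equivFun.injective
  rw [← hψ, isSingular_mapRange_iff hinj] at hφ
  rw [← hψ, isNull_mapRange_iff hinj]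
  exact hp ψ hφ

theorem noSingular_iff_zmod (K : Type*) [Field K] (p : ℕ) [CharP K p] :
    NoSingular G X K ↔ NoSingular G X (ZMod p) := by
  rcases CharP.char_is_prime_or_zero K p with hp | rfl
  · have := Fact.mk hp
    let _ : Algebra (ZMod p) K := ZMod.algebra K p
    exact ⟨fun h => h.of_injective (j := (algebraMap (ZMod p) K).toAddMonoidHom)
      (algebraMap (ZMod p) K).injective, fun h => h.of_forall_fg fun _ _ => inferInstance⟩
  · have : CharZero K := CharP.charP_to_charZero K
    change _ ↔ NoSingular G X ℤ
    refine ⟨fun h => h.of_injective (j := Int.castAddHom K) Int.cast_injective, fun h =>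
      h.of_forall_fg fun q hq => ?_⟩
    have : Module.Finite ℤ q := Module.Finite.iff_fg.mpr hq
    infer_instance

/-- The sum of the absolute values of the coefficients. -/
def l1Norm {α : Type*} (φ : α →₀ ℤ) : ℕ := φ.sum fun _ c => c.natAbs

theorem l1Norm_single {α : Type*} (a : α) (c : ℤ) : l1Norm (Finsupp.single a c) = c.natAbs :=
  Finsupp.sum_single_index Int.natAbs_zero

theorem l1Norm_eq_zero_iff {α : Type*} {φ : α →₀ ℤ} : l1Norm φ = 0 ↔ φ = 0 := by
  rw [l1Norm, Finsupp.sum, Finset.sum_eq_zero_iff, Finsupp.ext_iff]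
  refine forall_congr' fun a => ?_
  rw [Finsupp.mem_support_iff, Int.natAbs_eq_zero, Finsupp.zero_apply]
  tauto

theorem l1Norm_add_le {α : Type*} (φ ψ : α →₀ ℤ) : l1Norm (φ + ψ) ≤ l1Norm φ + l1Norm ψ := by
  classical
  have h (θ : α →₀ ℤ) (hθ : θ.support ⊆ φ.support ∪ ψ.support) :
      l1Norm θ = ∑ t ∈ φ.support ∪ ψ.support, (θ t).natAbs :=
    Finsupp.sum_of_support_subset _ hθ _ (by simp)
  rw [h _ Finsupp.support_add, h φ Finset.subset_union_left, h ψ Finset.subset_union_right,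
    ← Finset.sum_add_distrib]
  exact Finset.sum_le_sum fun t _ => Int.natAbs_add_le _ _

theorem l1Norm_mapDomain_le {α β : Type*} (f : α → β) (φ : α →₀ ℤ) :
    l1Norm (φ.mapDomain f) ≤ l1Norm φ := by
  rw [Finsupp.mapDomain, Finsupp.sum]
  refine (Finset.le_sum_of_subadditive l1Norm (l1Norm_eq_zero_iff.mpr rfl).le l1Norm_add_le
    _ _).trans_eq ?_
  simp only [l1Norm_single]
  rfl

theorem l1Norm_smul {α : Type*} (p : ℕ) (φ : α →₀ ℤ) : l1Norm (p • φ) = p * l1Norm φ := by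
  rw [l1Norm, Finsupp.sum_of_support_subset (p • φ) (s := φ.support) Finsupp.support_smul _
    (by simp), l1Norm, Finsupp.sum, Finset.mul_sum]
  simp [Int.natAbs_mul]

theorem l1Norm_lt_of_mapDomain_eq_smul {α β : Type*} {f : α → β} {φ : α →₀ ℤ} {ψ : β →₀ ℤ} {p : ℕ}
    (hp : 2 ≤ p) (hφ : φ ≠ 0) (h : φ.mapDomain f = p • ψ) : l1Norm ψ < l1Norm φ := by
  have h1 := l1Norm_mapDomain_le f φ
  rw [h, l1Norm_smul] at h1
  have := Nat.pos_of_ne_zero (mt l1Norm_eq_zero_iff.mp hφ)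
  nlinarith

theorem exists_smul_eq_of_mapRange_zmod {α : Type*} {p : ℕ} {φ : α →₀ ℤ}
    (h : φ.mapRange (Int.castAddHom (ZMod p)) (map_zero _) = 0) : ∃ ψ : α →₀ ℤ, φ = p • ψ := by
  refine ⟨φ.mapRange (· / (p : ℤ)) (by simp), ?_⟩
  ext t
  have h1 : ((φ t : ℤ) : ZMod p) = 0 := by simpa using DFunLike.congr_fun h t
  rw [CharP.intCast_eq_zero_iff (ZMod p) p] at h1
  simp [Int.mul_ediv_cancel' h1]

theorem isSingular_smul_iff {p : ℕ} (hp : p ≠ 0) {φ : Monomial G X →₀ ℤ} :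
    IsSingular (p • φ) ↔ IsSingular φ := by
  simp only [IsSingular, Finsupp.mapDomain_smul, smul_eq_zero, hp, false_or]

theorem isNull_smul_iff {p : ℕ} (hp : p ≠ 0) {φ : Monomial G X →₀ ℤ} :
    IsNull (p • φ) ↔ IsNull φ := by
  simp only [IsNull, Finsupp.mapDomain_smul, smul_eq_zero, hp, false_or]

/- Reduction modulo `p` shows that all long words turn a singular combination into `p` times a
singular combination, whose norm is smaller. -/
theorem NoSingular.int_of_zmod [Finite X] {p : ℕ} (hp : p.Prime) (h : NoSingular G X (ZMod p)) :
    NoSingular G X ℤ := by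
  intro φ hφ
  induction hN : l1Norm φ using Nat.strong_induction_on generalizing φ with
  | _ N ih =>
  rcases eq_or_ne φ 0 with rfl | h0
  · exact ⟨0, fun w _ => Finsupp.mapDomain_zero⟩
  obtain ⟨n, hn⟩ := h _ (hφ.mapRange (Int.castAddHom (ZMod p)))
  refine isNull_of_forall_mapDomain_mulWord n fun w hw => ?_
  obtain ⟨ψ, hψ⟩ : ∃ ψ, φ.mapDomain (mulWord w) = p • ψ := exists_smul_eq_of_mapRange_zmod <| by
    rw [← Finsupp.mapDomain_mapRange _ _ _ _ (map_add _), hn w hw]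
  have hsing := hφ.mapDomain_mulWord w
  rw [hψ, isSingular_smul_iff hp.ne_zero] at hsing
  rw [hψ, isNull_smul_iff hp.ne_zero]
  exact ih _ (hN ▸ l1Norm_lt_of_mapDomain_eq_smul hp.two_le h0 hψ) ψ hsing rfl

end Coefficients

section Families

variable {G X : Type*} [Group G] [MulAction G (List X)] [SelfSimilarGroup G X]
  {M : Type*} [AddCommMonoid M]

theorem exists_mapDomain_eq_of_support_subset_range {α β : Type*} {f : α → β} {φ : β →₀ M}
    (h : (φ.support : Set β) ⊆ Set.range f) : ∃ ψ : α →₀ M, ψ.mapDomain f = φ := by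
  rw [← Finsupp.mem_supported ℕ, ← Set.image_univ, ← Finsupp.lmapDomain_supported] at h
  obtain ⟨ψ, -, hψ⟩ := h
  exact ⟨ψ, hψ⟩

theorem mapDomain_mulWord_apply_append (φ : Monomial G X →₀ M) (u : List X) {v w : List X}
    (h : v.length = w.length) (k : G) : φ.mapDomain (mulWord w) (u ++ v, k) =
      ((φ.curry u).mapDomain (Prod.mk [])).mapDomain (mulWord w) (v, k) := by
  classical
  induction φ using Finsupp.induction_linear with
  | zero =>
    rw [show (0 : Monomial G X →₀ M).curry u = 0 from Finsupp.ext fun _ => rfl]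
    simp
  | add φ ψ hφ hψ =>
    have hcurry : (φ + ψ).curry u = φ.curry u + ψ.curry u := Finsupp.ext fun _ => rfl
    simp only [Finsupp.mapDomain_add, Finsupp.add_apply, hφ, hψ, hcurry]
  | single t c =>
    obtain ⟨u', k'⟩ := t
    rw [Finsupp.mapDomain_single, Finsupp.curry_single, Finsupp.single_apply,
      Finsupp.single_apply]
    have hiff : u' ++ k' • w = u ++ v ↔ u' = u ∧ k' • w = v :=
      List.append_eq_append_iff_of_size_eq_right (by simp [length_smul, h])
    rcases eq_or_ne u' u with rfl | hu
    · simp [mulWord, Finsupp.single_apply]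
    · simp [mulWord, hiff, hu]

theorem mapDomain_mulWord_mk_nil_apply_of_length_ne {f : G →₀ M} {v w : List X} (k : G)
    (h : v.length ≠ w.length) :
    (f.mapDomain (Prod.mk [])).mapDomain (mulWord w) (v, k) = 0 := by
  rw [← Finsupp.mapDomain_comp]
  refine Finsupp.mapDomain_of_notMem_range _ _ ?_
  rintro ⟨k', hk⟩
  refine h ?_
  have := length_fst_mulWord w (([] : List X), k')
  simp only [Function.comp_apply] at hk
  simpa [hk] using this

theorem IsSingular.curry {φ : Monomial G X →₀ M} (h : IsSingular φ) (u : List X) :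
    IsSingular ((φ.curry u).mapDomain (Prod.mk ([] : List X))) := fun v => by
  obtain ⟨w, hw⟩ := h v
  refine ⟨w, Finsupp.ext fun ⟨z, k⟩ => ?_⟩
  by_cases hz : z.length = (v ++ w).length
  · rw [← mapDomain_mulWord_apply_append φ u hz, hw]
    rfl
  · exact mapDomain_mulWord_mk_nil_apply_of_length_ne k hz

theorem isNull_of_forall_curry {φ : Monomial G X →₀ M}
    (h : ∀ u, IsNull ((φ.curry u).mapDomain (Prod.mk ([] : List X)))) : IsNull φ := by
  classical
  choose n hn using h
  refine ⟨φ.curry.support.sup n, fun w hw => ?_⟩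
  ext ⟨z, k⟩
  by_contra hne
  obtain ⟨⟨u, k'⟩, -, ht⟩ := Finset.mem_image.mp
    (Finsupp.mapDomain_support (Finsupp.mem_support_iff.mpr hne))
  obtain ⟨rfl, -⟩ : u ++ k' • w = z ∧ _ := Prod.mk.inj ht
  rw [mapDomain_mulWord_apply_append φ u (length_smul k' w)] at hne
  by_cases hu : u ∈ φ.curry.support
  · rw [mapDomain_mulWord_eq_zero_of_le (hn u) w (hw ▸ Finset.le_sup hu)] at hne
    exact hne rfl
  · simp [Finsupp.notMem_support_iff.mp hu] at hne

variable {ι : Type*} (g : ι → G)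

variable (X) in
/-- The family `g` absorbs the sections of every group element at all long words. -/
def ContractsTo : Prop :=
  ∀ h : G, ∃ n, ∀ w : List X, n ≤ w.length → sectWord h w ∈ Set.range g

variable (X) in
/-- The combination of the members of the family `g` with coefficients `f`. -/
noncomputable def ofFamily (f : ι →₀ M) : Monomial G X →₀ M := f.mapDomain fun i => ([], g i)

/-- The monomial `h w = h(w) h|_w`. -/
noncomputable def transition (h : G) (w : List X) : Monomial G X := (h • w, sectWord h w)

theorem mulWord_nil_mk (h : G) (w : List X) : mulWord w ([], h) = transition h w := rfl

theorem mapDomain_ofFamily (f : ι →₀ M) (w : List X) :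
    (ofFamily X g f).mapDomain (mulWord w) = f.mapDomain fun i => transition (g i) w := by
  rw [ofFamily, ← Finsupp.mapDomain_comp]
  rfl

variable {g} in
theorem noSingular_of_contractsTo [Finite X] (hg : ContractsTo X g)
    (h : ∀ f : ι →₀ M, IsSingular (ofFamily X g f) → IsNull (ofFamily X g f)) :
    NoSingular G X M := by
  classical
  intro φ hφ
  choose n hn using hg
  refine isNull_of_forall_mapDomain_mulWord (φ.support.sup fun t => n t.2) fun w hw =>
    isNull_of_forall_curry fun u => ?_
  have hsing := (hφ.mapDomain_mulWord w).curry u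
  obtain ⟨f, hf⟩ := exists_mapDomain_eq_of_support_subset_range (f := g)
      (φ := (φ.mapDomain (mulWord w)).curry u) fun k hk => by
    have hmem : (u, k) ∈ (φ.mapDomain (mulWord w)).support := by
      simpa [Finsupp.curry_apply] using hk
    obtain ⟨s, hs, hsk⟩ := Finset.mem_image.mp (Finsupp.mapDomain_support hmem)
    obtain ⟨-, rfl⟩ := Prod.mk.inj hsk
    exact hn s.2 w (hw ▸ Finset.le_sup (f := fun t : Monomial G X => n t.2) hs)
  rw [← hf, ← Finsupp.mapDomain_comp] at hsing ⊢
  exact h f hsing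

/-- The word `v` resolves the family `g` if members of the family with the same image of `v` have
the same section at `v`. -/
def Resolves (v : List X) : Prop :=
  ∀ i j, g i • v = g j • v → sectWord (g i) v = sectWord (g j) v

theorem exists_append_resolves [Finite ι] [Nontrivial X] (v : List X) :
    ∃ w, Resolves g (v ++ w) := by
  classical
  have := Fintype.ofFinite ι
  obtain ⟨w, hw⟩ := exists_forall_mulWord_eq_or_incomparable
    (Finset.univ.image fun i => (([] : List X), g i)) v
  refine ⟨w, fun i j hij => ?_⟩
  rcases hw _ (Finset.mem_image_of_mem _ (Finset.mem_univ i)) _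
    (Finset.mem_image_of_mem _ (Finset.mem_univ j)) with h | h
  · exact congrArg Prod.snd h
  · simp only [mulWord_nil_mk, transition, hij] at h
    exact absurd List.prefix_rfl h.1

variable {g} in
theorem IsSingular.mapDomain_eq_zero_of_resolves {f : ι →₀ M} (hf : IsSingular (ofFamily X g f))
    {v : List X} (hv : Resolves g v) : (ofFamily X g f).mapDomain (mulWord v) = 0 := by
  classical
  obtain ⟨w, hw⟩ := hf v
  rw [mapDomain_mulWord_append] at hw
  have hinj : Set.InjOn (mulWord w) (Set.range fun i => transition (g i) v) := by
    rintro _ ⟨i, rfl⟩ _ ⟨j, rfl⟩ hij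
    have h := fst_eq_of_mulWord_eq hij
    exact Prod.ext h (hv i j h)
  refine Finsupp.mapDomain_injOn _ hinj ?_ (by simp) (by rw [hw, Finsupp.mapDomain_zero])
  rw [mapDomain_ofFamily]
  intro t ht
  obtain ⟨i, _, rfl⟩ := Finset.mem_image.mp (Finsupp.mapDomain_support ht)
  exact ⟨i, rfl⟩

end Families

section Span

variable {ι : Type*}

/-- The vector over `K` with the given natural entries. -/
def castVector (K : Type*) [NatCast K] (r : ι → ℕ) : ι → K := fun i => r i

/-- The span over `K` of vectors with natural entries. -/
def castSpan (K : Type*) [Semiring K] (S : Set (ι → ℕ)) : Submodule K (ι → K) :=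
  Submodule.span K (castVector K '' S)

variable {G X : Type*} [Group G] [MulAction G (List X)] (g : ι → G)

open scoped Classical in
/-- The indicator function of the class of `i`, where two members of the family are equivalent if
they agree on the words that start with `w`. -/
noncomputable def classVector [SelfSimilarGroup G X] (w : List X) (i : ι) : ι → ℕ :=
  fun j => if transition (g j) w = transition (g i) w then 1 else 0

variable [SelfSimilarGroup G X]

theorem mapDomain_ofFamily_eq_zero_iff [Fintype ι] {K V : Type*} [Semiring K] [AddCommMonoid V]
    [Module K V] (f : ι →₀ V) (w : List X) : (ofFamily X g f).mapDomain (mulWord w) = 0 ↔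
      ∀ i, Fintype.linearCombination K f (castVector K (classVector g w i)) = 0 := by
  classical
  have happly (t : Monomial G X) : (ofFamily X g f).mapDomain (mulWord w) t =
      ∑ j, if transition (g j) w = t then f j else 0 := by
    rw [mapDomain_ofFamily, Finsupp.mapDomain, Finsupp.sum_fintype _ _ (by simp),
      Finsupp.finsetSum_apply]
    simp [Finsupp.single_apply]
  have hclass (i : ι) : Fintype.linearCombination K f (castVector K (classVector g w i)) =
      (ofFamily X g f).mapDomain (mulWord w) (transition (g i) w) := by
    rw [happly, Fintype.linearCombination_apply]
    simp [castVector, classVector]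
  simp only [hclass]
  refine ⟨fun h i => by rw [h]; rfl, fun h => Finsupp.ext fun t => ?_⟩
  by_cases ht : ∃ i, transition (g i) w = t
  · obtain ⟨i, rfl⟩ := ht
    exact h i
  · push Not at ht
    simp [happly, ht]

theorem mapDomain_ofFamily_mk_eq_zero_iff [Finite ι] [DecidableEq ι] {K : Type*} [Ring K]
    (p : Submodule K (ι → K)) (w : List X) :
    (ofFamily X g (Finsupp.equivFunOnFinite.symm fun i => p.mkQ (Pi.single i 1))).mapDomain
      (mulWord w) = 0 ↔ ∀ i, castVector K (classVector g w i) ∈ p := by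
  have := Fintype.ofFinite ι
  rw [mapDomain_ofFamily_eq_zero_iff (K := K)]
  refine forall_congr' fun i => ?_
  rw [Fintype.linearCombination_apply]
  conv_rhs =>
    rw [← p.ker_mkQ, LinearMap.mem_ker, pi_eq_sum_univ' (castVector K (classVector g w i)),
      map_sum]
  simp only [map_smul, Finsupp.equivFunOnFinite_symm_apply_apply]

variable {g} in
theorem classVector_append_mem [Finite ι] {K : Type*} [Ring K] {p : Submodule K (ι → K)}
    {w : List X} (h : ∀ i, castVector K (classVector g w i) ∈ p) (z : List X) (i : ι) :
    castVector K (classVector g (w ++ z) i) ∈ p := by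
  classical
  rw [← mapDomain_ofFamily_mk_eq_zero_iff] at h
  exact (mapDomain_ofFamily_mk_eq_zero_iff g p _).mp (mapDomain_mulWord_append_eq_zero h z) i

variable (X) in
/-- The class vectors at resolving words. -/
def resolvingVectors : Set (ι → ℕ) := {r | ∃ v : List X, Resolves g v ∧ ∃ i, classVector g v i = r}

variable {g} in
theorem NoSingular.exists_forall_classVector_mem [Finite ι] [Nontrivial X] {K : Type*} [Field K]
    (h : NoSingular G X K) : ∃ n, ∀ w : List X, w.length = n → ∀ i,
      castVector K (classVector g w i) ∈ castSpan K (resolvingVectors X g) := by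
  classical
  have hquot : NoSingular G X ((ι → K) ⧸ castSpan K (resolvingVectors X g)) :=
    h.of_forall_fg fun _ _ => inferInstance
  obtain ⟨n, hn⟩ := hquot (ofFamily X g (Finsupp.equivFunOnFinite.symm fun i =>
    (castSpan K (resolvingVectors X g)).mkQ (Pi.single i 1))) fun v => by
      obtain ⟨w, hw⟩ := exists_append_resolves g v
      exact ⟨w, (mapDomain_ofFamily_mk_eq_zero_iff g _ _).mpr fun i =>
        Submodule.subset_span (Set.mem_image_of_mem _ ⟨_, hw, i, rfl⟩)⟩
  exact ⟨n, fun w hw => (mapDomain_ofFamily_mk_eq_zero_iff g _ w).mp (hn w hw)⟩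

theorem noSingular_of_forall_classVector_mem [Finite X] [Finite ι] (hg : ContractsTo X g)
    {K : Type*} [CommSemiring K] {n : ℕ} (h : ∀ w : List X, w.length = n → ∀ i,
      castVector K (classVector g w i) ∈ castSpan K (resolvingVectors X g)) :
    NoSingular G X K := by
  have := Fintype.ofFinite ι
  refine noSingular_of_contractsTo hg fun f hf => ⟨n, fun w hw => ?_⟩
  have hker : castSpan K (resolvingVectors X g) ≤
      LinearMap.ker (Fintype.linearCombination K (f : ι → K)) := by
    rw [castSpan, Submodule.span_le]
    rintro _ ⟨_, ⟨v, hv, i, rfl⟩, rfl⟩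
    exact (mapDomain_ofFamily_eq_zero_iff g f v).mp (hf.mapDomain_eq_zero_of_resolves hv) i
  exact (mapDomain_ofFamily_eq_zero_iff g f w).mpr fun i => hker (h w hw i)

end Span

section Recurrence

variable {ι G X : Type*} [Group G] [MulAction G (List X)] [SelfSimilarGroup G X] (g : ι → G)

/-- The part of the behaviour of the family `g` at the word `w` which determines its behaviour at
all extensions of `w`: the sections, and which members have the same image of `w`. -/
noncomputable def wordState (w : List X) : (ι → G) × (ι → ι → Prop) :=
  (fun i => sectWord (g i) w, fun i j => g i • w = g j • w)

variable {g} in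
theorem wordState_append_congr {w w' : List X} (h : wordState g w = wordState g w')
    (z : List X) : wordState g (w ++ z) = wordState g (w' ++ z) := by
  obtain ⟨hsect, himage⟩ := Prod.mk.inj h
  have happend (v : List X) (i j : ι) : g i • (v ++ z) = g j • (v ++ z) ↔
      g i • v = g j • v ∧ sectWord (g i) v • z = sectWord (g j) v • z := by
    rw [smul_append, smul_append]
    exact List.append_eq_append_iff_of_size_eq_left (by simp [length_smul])
  refine Prod.ext (funext fun i => ?_) (funext fun i => funext fun j => propext ?_)
  · simp only [wordState, sectWord_append, congrFun hsect i]
  · simp only [wordState, happend, congrFun hsect, congrFun (congrFun himage i) j]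

variable {g} in
theorem classVector_congr {w w' : List X} (h : wordState g w = wordState g w') :
    classVector g w = classVector g w' := by
  obtain ⟨hsect, himage⟩ := Prod.mk.inj h
  funext i j
  have h : transition (g j) w = transition (g i) w ↔ transition (g j) w' = transition (g i) w' := by
    simp only [transition, Prod.mk.injEq, congrFun hsect, congrFun (congrFun himage j) i]
  rw [classVector, classVector]
  congr 1
  exact propext h

variable {g} in
theorem resolves_congr {w w' : List X} (h : wordState g w = wordState g w') :
    Resolves g w ↔ Resolves g w' := by
  obtain ⟨hsect, himage⟩ := Prod.mk.inj h
  refine forall_congr' fun i => forall_congr' fun j => ?_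
  rw [congrFun (congrFun himage i) j, congrFun hsect i, congrFun hsect j]

variable (X) in
/-- The words of length `m` and those of length `n` have the same states. -/
def SameStates (m n : ℕ) : Prop :=
  wordState g '' {w : List X | w.length = m} = wordState g '' {w : List X | w.length = n}

variable {g}

theorem SameStates.symm {m n : ℕ} (h : SameStates X g m n) : SameStates X g n m := Eq.symm h

theorem SameStates.exists_wordState_eq {m n : ℕ} (h : SameStates X g m n) {w : List X}
    (hw : w.length = m) : ∃ w' : List X, w'.length = n ∧ wordState g w' = wordState g w :=
  h.subset (Set.mem_image_of_mem _ hw)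

theorem SameStates.exists_length_lt {m n : ℕ} (h : SameStates X g m n) (hmn : m < n)
    (v : List X) : ∃ v' : List X, v'.length < n ∧ wordState g v' = wordState g v := by
  induction hl : v.length using Nat.strong_induction_on generalizing v with
  | _ l ih =>
  rcases lt_or_ge l n with hln | hln
  · exact ⟨v, hl.trans_lt hln, rfl⟩
  obtain ⟨u, hu, hstate⟩ := h.symm.exists_wordState_eq (w := v.take n) (by simp; omega)
  obtain ⟨v', hv', hvstate⟩ := ih (u ++ v.drop n).length (by simp; omega) (u ++ v.drop n) rfl
  refine ⟨v', hv', hvstate.trans ?_⟩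
  simpa using wordState_append_congr hstate (v.drop n)

theorem SameStates.exists_le_length {m n : ℕ} (h : SameStates X g m n) (hmn : m < n) (l : ℕ)
    {w : List X} (hw : m ≤ w.length) :
    ∃ w' : List X, l ≤ w'.length ∧ wordState g w' = wordState g w := by
  induction l generalizing w with
  | zero => exact ⟨w, Nat.zero_le _, rfl⟩
  | succ l ih =>
    obtain ⟨v, hv, hvstate⟩ := ih hw
    rcases hv.lt_or_eq with hlt | rfl
    · exact ⟨v, hlt, hvstate⟩
    by_cases hmv : m ≤ v.length
    · obtain ⟨u, hu, hstate⟩ := h.exists_wordState_eq (w := v.take m) (by simpa using hmv)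
      refine ⟨u ++ v.drop m, by simp; omega, ?_⟩
      rw [← hvstate]
      simpa using wordState_append_congr hstate (v.drop m)
    · exact ⟨w, by omega, rfl⟩

variable (X g) in
/-- The class vectors at the resolving words shorter than `n`. -/
def shortResolvingVectors (n : ℕ) : Set (ι → ℕ) :=
  {r | ∃ v : List X, v.length < n ∧ Resolves g v ∧ ∃ i, classVector g v i = r}

theorem finite_shortResolvingVectors [Finite X] [Finite ι] (n : ℕ) :
    (shortResolvingVectors X g n).Finite := by
  refine (((List.finite_length_lt X n).prod Set.finite_univ).image
    fun p : List X × ι => classVector g p.1 p.2).subset ?_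
  rintro _ ⟨v, hv, -, i, rfl⟩
  exact ⟨(v, i), ⟨hv, trivial⟩, rfl⟩

theorem SameStates.shortResolvingVectors_eq {m n : ℕ} (h : SameStates X g m n) (hmn : m < n) :
    shortResolvingVectors X g n = resolvingVectors X g := by
  ext r
  constructor
  · rintro ⟨v, -, hv, i, rfl⟩
    exact ⟨v, hv, i, rfl⟩
  · rintro ⟨v, hv, i, rfl⟩
    obtain ⟨v', hl, hstate⟩ := h.exists_length_lt hmn v
    exact ⟨v', hl, (resolves_congr hstate).mpr hv, i, by rw [classVector_congr hstate]⟩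

/- The words of length `m` recur among arbitrarily long words, and the span of the class vectors
shrinks when words are extended. -/
theorem noSingular_iff_of_sameStates [Finite X] [Nontrivial X] [Finite ι] (hg : ContractsTo X g)
    {m n : ℕ} (h : SameStates X g m n) (hmn : m < n) (K : Type*) [Field K] :
    NoSingular G X K ↔ ∀ w : List X, w.length = m → ∀ i,
      castVector K (classVector g w i) ∈ castSpan K (shortResolvingVectors X g n) := by
  rw [h.shortResolvingVectors_eq hmn]
  refine ⟨fun hK w hw i => ?_, noSingular_of_forall_classVector_mem g hg⟩
  obtain ⟨l, hl⟩ := hK.exists_forall_classVector_mem (g := g)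
  obtain ⟨v, hv, hstate⟩ := h.exists_le_length hmn l hw.ge
  rw [← classVector_congr hstate, ← List.take_append_drop l v]
  exact classVector_append_mem (hl _ (by simpa using hv)) _ i

theorem ContractsTo.exists_sameStates [Finite ι] (hg : ContractsTo X g) :
    ∃ m n, m < n ∧ SameStates X g m n := by
  choose n hn using fun i => hg (g i)
  obtain ⟨N, hN⟩ := (Set.finite_range n).bddAbove
  have hfin : (Set.pi Set.univ (fun _ : ι => Set.range g) ×ˢ
      (Set.univ : Set (ι → ι → Prop))).Finite :=
    (Set.Finite.pi' fun _ => Set.finite_range g).prod Set.finite_univ |>.subset (by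
      intro s hs; simpa [Set.mem_pi] using hs)
  obtain ⟨a, -, b, -, hab, heq⟩ := (Set.Ici_infinite N).exists_lt_map_eq_of_mapsTo
    (f := fun l => wordState g '' {w : List X | w.length = l}) (fun l hl => by
      rintro _ ⟨w, hw, rfl⟩
      exact ⟨fun i _ => hn i w ((hN ⟨i, rfl⟩).trans (hl.trans hw.ge)), trivial⟩) hfin.finite_subsets
  exact ⟨a, b, hab, heq⟩

theorem IsContracting.exists_contractsTo [Finite X] (h : IsContracting G X) :
    ∃ N : Finset G, ContractsTo X ((↑) : N → G) := by
  obtain ⟨N, hN⟩ := h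
  have hsect (w : List X) : ∀ a ∈ N.states, sectWord a w ∈ N.states := by
    induction w with
    | nil => exact fun a ha => ha
    | cons x _ ih => exact fun a ha => ih _ (N.sect_mem a ha x)
  refine ⟨N.states, fun k => ?_⟩
  obtain ⟨n, hn⟩ := hN k
  refine ⟨n, fun w hw => ⟨⟨sectWord k w, ?_⟩, rfl⟩⟩
  rw [← List.take_append_drop n w, sectWord_append]
  exact hsect _ _ (hn _ (by simpa using hw))

end Recurrence

section Characteristic

variable {ι κ : Type*}

theorem exists_mul_eq_natCast_sub_natCast [Finite κ] (q : κ → ℚ) :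
    ∃ D : ℕ, D ≠ 0 ∧ ∃ a b : κ → ℕ, ∀ k, D * q k = a k - b k := by
  have := Fintype.ofFinite κ
  refine ⟨∏ k, (q k).den, Finset.prod_ne_zero_iff.mpr fun k _ => (q k).den_nz, ?_⟩
  have hint (k : κ) : ∃ z : ℤ, ((∏ k, (q k).den : ℕ) : ℚ) * q k = z := by
    obtain ⟨e, he⟩ := Finset.dvd_prod_of_mem (fun k => (q k).den) (Finset.mem_univ k)
    refine ⟨e * (q k).num, ?_⟩
    rw [he]
    push_cast
    rw [mul_right_comm, mul_comm ((q k).den : ℚ), Rat.mul_den_eq_num, mul_comm]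
  choose z hz using hint
  refine ⟨fun k => (z k).toNat, fun k => (-z k).toNat, fun k => ?_⟩
  rw [hz]
  exact_mod_cast (Int.toNat_sub_toNat_neg (z k)).symm

theorem mem_castSpan_range_iff [Fintype κ] {K : Type*} [Semiring K] {r : ι → ℕ}
    {s : κ → ι → ℕ} : castVector K r ∈ castSpan K (Set.range s) ↔
      ∃ c : κ → K, ∀ i, ∑ k, c k * (s k i : K) = r i := by
  rw [castSpan, ← Set.range_comp, Submodule.mem_span_range_iff_exists_fun]
  simp [funext_iff, castVector]

theorem mem_castSpan_of_natCast_ne_zero [Fintype κ] {r : ι → ℕ} {s : κ → ι → ℕ} {D : ℕ}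
    {a b : κ → ℕ} (h : ∀ i, D * r i + ∑ k, b k * s k i = ∑ k, a k * s k i) {K : Type*} [Field K]
    (hD : (D : K) ≠ 0) : castVector K r ∈ castSpan K (Set.range s) := by
  refine mem_castSpan_range_iff.mpr ⟨fun k => (D : K)⁻¹ * (a k - b k), fun i => ?_⟩
  have hi : (D : K) * r i + ∑ k, (b k : K) * s k i = ∑ k, (a k : K) * s k i :=
    mod_cast congrArg (Nat.cast : ℕ → K) (h i)
  simp only [mul_assoc, ← Finset.mul_sum, sub_mul, Finset.sum_sub_distrib, ← hi,
    add_sub_cancel_right]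
  exact inv_mul_cancel_left₀ hD _

theorem mem_castSpan_rat_iff [Fintype κ] {r : ι → ℕ} {s : κ → ι → ℕ} :
    castVector ℚ r ∈ castSpan ℚ (Set.range s) ↔ ∃ D : ℕ, D ≠ 0 ∧ ∃ a b : κ → ℕ,
      ∀ i, D * r i + ∑ k, b k * s k i = ∑ k, a k * s k i := by
  constructor
  · intro h
    obtain ⟨c, hc⟩ := mem_castSpan_range_iff.mp h
    obtain ⟨D, hD, a, b, hab⟩ := exists_mul_eq_natCast_sub_natCast c
    refine ⟨D, hD, a, b, fun i => ?_⟩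
    have h : (D : ℚ) * r i = ∑ k, (a k : ℚ) * s k i - ∑ k, (b k : ℚ) * s k i := by
      simp only [← hc, Finset.mul_sum, ← mul_assoc, hab, sub_mul, Finset.sum_sub_distrib]
    rw [eq_sub_iff_add_eq] at h
    exact_mod_cast h
  · rintro ⟨D, hD, a, b, h⟩
    exact mem_castSpan_of_natCast_ne_zero h (Nat.cast_ne_zero.mpr hD)

theorem exists_forall_mem_castSpan {R S : Set (ι → ℕ)} (hR : R.Finite) (hS : S.Finite)
    (h : ∀ r ∈ R, castVector ℚ r ∈ castSpan ℚ S) : ∃ D : ℕ, D ≠ 0 ∧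
      ∀ (K : Type*) [Field K], (D : K) ≠ 0 → ∀ r ∈ R, castVector K r ∈ castSpan K S := by
  have := hS.fintype
  rw [← Subtype.range_coe (s := S)] at h ⊢
  choose! D hD a b hab using fun r hr => mem_castSpan_rat_iff.mp (h r hr)
  refine ⟨∏ r ∈ hR.toFinset, D r, Finset.prod_ne_zero_iff.mpr fun r hr =>
    hD r (hR.mem_toFinset.mp hr), fun K _ hK r hr =>
      mem_castSpan_of_natCast_ne_zero (hab r hr) ?_⟩
  rw [Nat.cast_prod] at hK
  exact Finset.prod_ne_zero_iff.mp hK r (hR.mem_toFinset.mpr hr)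

theorem mem_castSpan_zmod_iff [Fintype κ] {p : ℕ} [NeZero p] {r : ι → ℕ} {s : κ → ι → ℕ} :
    castVector (ZMod p) r ∈ castSpan (ZMod p) (Set.range s) ↔
      ∃ c : κ → ℕ, (∀ k, c k < p) ∧ ∀ i, ∑ k, c k * s k i ≡ r i [MOD p] := by
  rw [mem_castSpan_range_iff]
  constructor
  · rintro ⟨c, hc⟩
    refine ⟨fun k => (c k).val, fun k => (c k).val_lt, fun i => ?_⟩
    rw [← ZMod.natCast_eq_natCast_iff]
    simpa using hc i
  · rintro ⟨c, -, hc⟩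
    refine ⟨fun k => c k, fun i => ?_⟩
    have := (ZMod.natCast_eq_natCast_iff _ _ p).mpr (hc i)
    simpa using this

theorem exists_separating_of_notMem_castSpan_rat [Fintype ι] {r : ι → ℕ} {S : Set (ι → ℕ)}
    (h : castVector ℚ r ∉ castSpan ℚ S) : ∃ a b : ι → ℕ,
      (∀ s ∈ S, ∑ i, a i * s i = ∑ i, b i * s i) ∧ ∑ i, a i * r i ≠ ∑ i, b i * r i := by
  classical
  obtain ⟨f, hfr, hf⟩ := Submodule.exists_le_ker_of_notMem h
  obtain ⟨D, hD, a, b, hab⟩ := exists_mul_eq_natCast_sub_natCast fun i => f (Pi.single i 1)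
  have hdot (s : ι → ℕ) : D * f (castVector ℚ s) =
      ((∑ i, a i * s i : ℕ) : ℚ) - ((∑ i, b i * s i : ℕ) : ℚ) := by
    rw [pi_eq_sum_univ' (castVector ℚ s), map_sum, Finset.mul_sum]
    push_cast
    rw [← Finset.sum_sub_distrib]
    refine Finset.sum_congr rfl fun i _ => ?_
    rw [map_smul, smul_eq_mul, castVector, mul_left_comm, hab]
    ring
  refine ⟨a, b, fun s hs => ?_, fun heq => ?_⟩
  · have := hdot s
    rw [hf (Submodule.subset_span (Set.mem_image_of_mem _ hs)), mul_zero] at this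
    exact_mod_cast (sub_eq_zero.mp this.symm)
  · have := hdot r
    rw [heq, sub_self] at this
    exact (mul_ne_zero (Nat.cast_ne_zero.mpr hD) hfr) this

theorem notMem_castSpan_rat_iff [Fintype ι] {r : ι → ℕ} {S : Set (ι → ℕ)} :
    castVector ℚ r ∉ castSpan ℚ S ↔ ∃ a b : ι → ℕ,
      (∀ s ∈ S, ∑ i, a i * s i = ∑ i, b i * s i) ∧ ∑ i, a i * r i ≠ ∑ i, b i * r i := by
  refine ⟨exists_separating_of_notMem_castSpan_rat, ?_⟩
  rintro ⟨a, b, hS, hr⟩ hmem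
  have hdot (s : ι → ℕ) :
      Fintype.linearCombination ℚ (fun i => (a i - b i : ℚ)) (castVector ℚ s) =
        ((∑ i, a i * s i : ℕ) : ℚ) - ((∑ i, b i * s i : ℕ) : ℚ) := by
    simp [Fintype.linearCombination_apply, castVector, ← Finset.sum_sub_distrib, ← sub_mul,
      mul_comm]
  have hker : castSpan ℚ S ≤
      LinearMap.ker (Fintype.linearCombination ℚ fun i => (a i - b i : ℚ)) := by
    rw [castSpan, Submodule.span_le]
    rintro _ ⟨s, hs, rfl⟩
    rw [SetLike.mem_coe, LinearMap.mem_ker, hdot, hS s hs, sub_self]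
  have := hker hmem
  rw [LinearMap.mem_ker, hdot, sub_eq_zero] at this
  exact hr (mod_cast this)

end Characteristic

section Dichotomy

variable {G X : Type*} [Group G] [MulAction G (List X)] [SelfSimilarGroup G X]

theorem IsContracting.finite_setOf_not_noSingular_zmod [Finite X] [Nontrivial X]
    (hcon : IsContracting G X) (h : NoSingular G X ℚ) :
    {p : ℕ | p.Prime ∧ ¬ NoSingular G X (ZMod p)}.Finite := by
  obtain ⟨N, hN⟩ := hcon.exists_contractsTo
  obtain ⟨m, n, hmn, hsame⟩ := hN.exists_sameStates
  have hR : {r | ∃ w : List X, w.length = m ∧ ∃ i, classVector ((↑) : N → G) w i = r}.Finite := by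
    refine (((List.finite_length_eq X m).prod Set.finite_univ).image
      fun q : List X × N => classVector ((↑) : N → G) q.1 q.2).subset ?_
    rintro _ ⟨w, hw, i, rfl⟩
    exact ⟨(w, i), ⟨hw, trivial⟩, rfl⟩
  obtain ⟨D, hD, hspan⟩ := exists_forall_mem_castSpan hR (finite_shortResolvingVectors n) (by
    rintro _ ⟨w, hw, i, rfl⟩
    exact (noSingular_iff_of_sameStates hN hsame hmn ℚ).mp h w hw i)
  refine D.primeFactors.finite_toSet.subset ?_
  rintro p ⟨hp, hpN⟩
  have := Fact.mk hp
  refine Nat.mem_primeFactors.mpr ⟨hp, by_contra fun hpD => hpN ?_, hD⟩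
  refine (noSingular_iff_of_sameStates hN hsame hmn (ZMod p)).mpr fun w hw i =>
    hspan (ZMod p) (mt (ZMod.natCast_eq_zero_iff D p).mp hpD) _ ⟨w, hw, i, rfl⟩

end Dichotomy

attribute [local fun_prop] Primrec Primrec.id Primrec.const Primrec.comp Primrec.fst Primrec.snd
  Primrec.pair Primrec.cond

section Primrec

variable {α β γ : Type*} [Primcodable α] [Primcodable β] [Primcodable γ]

@[fun_prop]
theorem primrec_add {f g : α → ℕ} (hf : Primrec f) (hg : Primrec g) :
    Primrec fun a => f a + g a := Primrec.nat_add.comp hf hg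

@[fun_prop]
theorem primrec_mul {f g : α → ℕ} (hf : Primrec f) (hg : Primrec g) :
    Primrec fun a => f a * g a := Primrec.nat_mul.comp hf hg

@[fun_prop]
theorem primrec_div {f g : α → ℕ} (hf : Primrec f) (hg : Primrec g) :
    Primrec fun a => f a / g a := Primrec.nat_div.comp hf hg

@[fun_prop]
theorem primrec_mod {f g : α → ℕ} (hf : Primrec f) (hg : Primrec g) :
    Primrec fun a => f a % g a := Primrec.nat_mod.comp hf hg

@[fun_prop]
theorem primrec_decide_lt {f g : α → ℕ} (hf : Primrec f) (hg : Primrec g) :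
    Primrec fun a => decide (f a < g a) :=
  primrecPred_iff_primrec_decide.mp (Primrec.nat_lt.comp hf hg)

@[fun_prop]
theorem primrec_decide_eq [DecidableEq β] {f g : α → β} (hf : Primrec f) (hg : Primrec g) :
    Primrec fun a => decide (f a = g a) :=
  primrecPred_iff_primrec_decide.mp (Primrec.eq.comp hf hg)

@[fun_prop]
theorem primrec_and {f g : α → Bool} (hf : Primrec f) (hg : Primrec g) :
    Primrec fun a => f a && g a := Primrec.and.comp hf hg

@[fun_prop]
theorem primrec_or {f g : α → Bool} (hf : Primrec f) (hg : Primrec g) :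
    Primrec fun a => f a || g a := Primrec.or.comp hf hg

@[fun_prop]
theorem primrec_not {f : α → Bool} (hf : Primrec f) : Primrec fun a => !f a :=
  Primrec.not.comp hf

@[fun_prop]
theorem primrec_some {f : α → β} (hf : Primrec f) : Primrec fun a => some (f a) :=
  Primrec.option_some.comp hf

@[fun_prop]
theorem primrec_cons {f : α → β} {l : α → List β} (hf : Primrec f) (hl : Primrec l) :
    Primrec fun a => f a :: l a := Primrec.list_cons.comp hf hl

@[fun_prop]
theorem primrec_length {l : α → List β} (hl : Primrec l) : Primrec fun a => (l a).length :=
  Primrec.list_length.comp hl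

@[fun_prop]
theorem primrec_getD {l : α → List β} {n : α → ℕ} {b : β} (hl : Primrec l) (hn : Primrec n) :
    Primrec fun a => (l a).getD (n a) b := (Primrec.list_getD b).comp hl hn

@[fun_prop]
theorem primrec_range {n : α → ℕ} (hn : Primrec n) : Primrec fun a => List.range (n a) :=
  Primrec.list_range.comp hn

@[fun_prop]
theorem primrec_map {l : α → List β} {f : α → β → γ} (hl : Primrec l)
    (hf : Primrec fun q : α × β => f q.1 q.2) : Primrec fun a => (l a).map (f a) :=
  Primrec.list_map hl hf

@[fun_prop]
theorem primrec_flatMap {l : α → List β} {f : α → β → List γ} (hl : Primrec l)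
    (hf : Primrec fun q : α × β => f q.1 q.2) : Primrec fun a => (l a).flatMap (f a) :=
  Primrec.list_flatMap hl hf

@[fun_prop]
theorem primrec_filter {l : α → List β} {p : α → β → Bool} (hl : Primrec l)
    (hp : Primrec fun q : α × β => p q.1 q.2) : Primrec fun a => (l a).filter (p a) :=
  (Primrec.list_flatMap (g := fun a b => bif p a b then [b] else []) hl (by
    change Primrec fun q : α × β => bif p q.1 q.2 then [q.2] else []
    fun_prop)).of_eq fun a => by
      induction l a with
      | nil => rfl
      | cons b l ih => cases h : p a b <;> simp_all

@[fun_prop]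
theorem primrec_all {l : α → List β} {p : α → β → Bool} (hl : Primrec l)
    (hp : Primrec fun q : α × β => p q.1 q.2) : Primrec fun a => (l a).all (p a) := by
  have h : Primrec fun a => decide (((l a).filter fun b => !p a b).length = 0) := by fun_prop
  exact h.of_eq fun a => by rw [Bool.eq_iff_iff]; simp

@[fun_prop]
theorem primrec_any {l : α → List β} {p : α → β → Bool} (hl : Primrec l)
    (hp : Primrec fun q : α × β => p q.1 q.2) : Primrec fun a => (l a).any (p a) := by
  have h : Primrec fun a => !(l a).all fun b => !p a b := by fun_prop
  exact h.of_eq fun a => by rw [Bool.eq_iff_iff]; simp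

@[fun_prop]
theorem primrec_findIdx {l : α → List β} {p : α → β → Bool} (hl : Primrec l)
    (hp : Primrec fun q : α × β => p q.1 q.2) : Primrec fun a => (l a).findIdx (p a) :=
  Primrec.list_findIdx hl hp

@[fun_prop]
theorem primrec_foldl {l : α → List β} {s : α → γ} {f : α → γ → β → γ} (hl : Primrec l)
    (hs : Primrec s) (hf : Primrec fun q : α × γ × β => f q.1 q.2.1 q.2.2) :
    Primrec fun a => (l a).foldl (f a) (s a) :=
  Primrec.list_foldl (h := fun a q => f a q.1 q.2) hl hs hf

@[fun_prop]
theorem primrec_foldr {l : α → List β} {s : α → γ} {f : α → β → γ → γ} (hl : Primrec l)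
    (hs : Primrec s) (hf : Primrec fun q : α × β × γ => f q.1 q.2.1 q.2.2) :
    Primrec fun a => (l a).foldr (f a) (s a) :=
  Primrec.list_foldr (h := fun a q => f a q.1 q.2) hl hs hf

@[fun_prop]
theorem primrec_sum {l : α → List ℕ} (hl : Primrec l) : Primrec fun a => (l a).sum := by
  have h : Primrec fun a => (l a).foldr (fun b s => b + s) 0 := by fun_prop
  exact h

@[fun_prop]
theorem primrec_decide_prime {n : α → ℕ} (hn : Primrec n) :
    Primrec fun a => decide (n a).Prime := by
  have h : Primrec fun a => decide (1 < n a) &&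
      (List.range (n a)).all fun m => !decide (n a % m = 0) || decide (m = 1) := by fun_prop
  refine h.of_eq fun a => ?_
  rw [Bool.eq_iff_iff]
  simp [Nat.prime_def_lt, Nat.dvd_iff_mod_eq_zero, Nat.succ_le_iff,
    imp_iff_not_or]

/-- All words of length `n` over the letters `0, …, c - 1`. -/
def words (c : ℕ) : ℕ → List (List ℕ)
  | 0 => [[]]
  | n + 1 => (words c n).flatMap fun w => (List.range c).map fun x => x :: w

theorem mem_words {c n : ℕ} {w : List ℕ} : w ∈ words c n ↔ w.length = n ∧ ∀ x ∈ w, x < c := by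
  induction n generalizing w with
  | zero => simp +contextual [words]
  | succ n ih =>
    cases w with
    | nil => simp [words]
    | cons x w => simp [words, ih]; tauto

theorem mem_words_succ {c n : ℕ} {w : List ℕ} :
    w ∈ words c (n + 1) ↔ ∃ x < c, ∃ v ∈ words c n, w = x :: v := by
  simp only [words, List.mem_flatMap, List.mem_map, List.mem_range]
  grind

@[fun_prop]
theorem primrec_words {c n : α → ℕ} (hc : Primrec c) (hn : Primrec n) :
    Primrec fun a => words (c a) (n a) := by
  have h : Primrec fun a => (List.range (n a)).foldl
      (fun l _ => l.flatMap fun w => (List.range (c a)).map fun x => x :: w) [[]] := by fun_prop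
  refine h.of_eq fun a => ?_
  induction n a with
  | zero => rfl
  | succ n ih => simp only [List.range_succ, List.foldl_append, ih]; rfl

end Primrec

section ExceptionalPrimes

/-- The vector of length `u` that the list `l` codes, padded with zeros. -/
def vectorOfList (u : ℕ) (l : List ℕ) : Fin u → ℕ := fun i => l.getD i 0

/-- The inner product of the vectors of length `n` coded by `a` and `b`. -/
def dot (n : ℕ) (a b : List ℕ) : ℕ :=
  ((List.range n).map fun k => a.getD k 0 * b.getD k 0).sum

/-- The `i`-th coordinate of each of the vectors in `S`. -/
def column (S : List (List ℕ)) (i : ℕ) : List ℕ := S.map fun s => s.getD i 0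

/-- The functional `a - b` vanishes on `S`, but not at `r`. -/
def separates (u : ℕ) (S : List (List ℕ)) (r a b : List ℕ) : Bool :=
  (S.all fun s => decide (dot u a s = dot u b s)) && !decide (dot u a r = dot u b r)

/-- The vector `D r` is the combination of the vectors in `S` with coefficients `a - b`. -/
def expresses (u : ℕ) (S : List (List ℕ)) (r : List ℕ) (D : ℕ) (a b : List ℕ) : Bool :=
  (List.range u).all fun i =>
    decide (D * r.getD i 0 + dot S.length b (column S i) = dot S.length a (column S i))

/-- The vectors in `R` lie in the span of `S` modulo `p`. -/
def spansMod (u : ℕ) (R S : List (List ℕ)) (p : ℕ) : Bool :=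
  R.all fun r => (words p S.length).any fun c => (List.range u).all fun i =>
    decide (dot S.length c (column S i) % p = r.getD i 0 % p)

/-- Numbers less than `B` show that some vector in `R` is not in the span of `S` over `ℚ`. -/
def separatesSome (u : ℕ) (R S : List (List ℕ)) (B : ℕ) : Bool :=
  R.any fun r => (words B u).any fun a => (words B u).any fun b => separates u S r a b

/-- Numbers less than `B` show that all vectors in `R` are in the span of `S` over `ℚ`. -/
def expressesAll (u : ℕ) (R S : List (List ℕ)) (B : ℕ) : Bool :=
  R.all fun r => (List.range B).any fun D => decide (0 < D) &&
    (words B S.length).any fun a => (words B S.length).any fun b => expresses u S r D a b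

/-- The outcome of the search for a proof that `R` is not, or is, in the span of `S` over `ℚ` with
numbers less than `B`. In the second case the primes from `B` on do not divide the denominators. -/
def searchExceptionalPrimes (u : ℕ) (R S : List (List ℕ)) (B : ℕ) : Option (Option (List ℕ)) :=
  bif separatesSome u R S B then some none
  else bif expressesAll u R S B then
    some (some ((List.range B).filter fun p => decide p.Prime && !spansMod u R S p))
  else none

/-- The algorithm that finds the primes modulo which `R` is not in the span of `S`, if `R` is in the
span of `S` over `ℚ`. The input consists of the length of the vectors, `R` and `S`. -/
def exceptionalPrimes (q : ℕ × List (List ℕ) × List (List ℕ)) : Part (Option (List ℕ)) :=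
  Nat.rfindOpt (searchExceptionalPrimes q.1 q.2.1 q.2.2)

section Primrec

variable {α : Type*} [Primcodable α] {u D p : α → ℕ} {R S : α → List (List ℕ)}
  {r a b : α → List ℕ}

@[fun_prop]
theorem primrec_dot (hu : Primrec u) (ha : Primrec a) (hb : Primrec b) :
    Primrec fun x => dot (u x) (a x) (b x) := by
  unfold dot
  fun_prop

@[fun_prop]
theorem primrec_column {i : α → ℕ} (hS : Primrec S) (hi : Primrec i) :
    Primrec fun x => column (S x) (i x) := by
  unfold column
  fun_prop

@[fun_prop]
theorem primrec_separates (hu : Primrec u) (hS : Primrec S) (hr : Primrec r) (ha : Primrec a)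
    (hb : Primrec b) : Primrec fun x => separates (u x) (S x) (r x) (a x) (b x) := by
  unfold separates
  fun_prop

@[fun_prop]
theorem primrec_expresses (hu : Primrec u) (hS : Primrec S) (hr : Primrec r) (hD : Primrec D)
    (ha : Primrec a) (hb : Primrec b) :
    Primrec fun x => expresses (u x) (S x) (r x) (D x) (a x) (b x) := by
  unfold expresses
  fun_prop

@[fun_prop]
theorem primrec_spansMod (hu : Primrec u) (hR : Primrec R) (hS : Primrec S) (hp : Primrec p) :
    Primrec fun x => spansMod (u x) (R x) (S x) (p x) := by
  unfold spansMod
  fun_prop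

@[fun_prop]
theorem primrec_separatesSome {B : α → ℕ} (hu : Primrec u) (hR : Primrec R) (hS : Primrec S)
    (hB : Primrec B) : Primrec fun x => separatesSome (u x) (R x) (S x) (B x) := by
  unfold separatesSome
  fun_prop

@[fun_prop]
theorem primrec_expressesAll {B : α → ℕ} (hu : Primrec u) (hR : Primrec R) (hS : Primrec S)
    (hB : Primrec B) : Primrec fun x => expressesAll (u x) (R x) (S x) (B x) := by
  unfold expressesAll
  fun_prop

@[fun_prop]
theorem primrec_searchExceptionalPrimes {B : α → ℕ} (hu : Primrec u) (hR : Primrec R)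
    (hS : Primrec S) (hB : Primrec B) :
    Primrec fun x => searchExceptionalPrimes (u x) (R x) (S x) (B x) := by
  unfold searchExceptionalPrimes
  fun_prop

theorem partrec_exceptionalPrimes : Partrec exceptionalPrimes := by
  have h : Primrec fun q : (ℕ × List (List ℕ) × List (List ℕ)) × ℕ =>
      searchExceptionalPrimes q.1.1 q.1.2.1 q.1.2.2 q.2 := by fun_prop
  exact Partrec.rfindOpt h.to_comp

end Primrec

section Correctness

variable {u p B : ℕ} {R S : List (List ℕ)} {r a b : List ℕ}

/-- The set of the vectors of length `u` that the lists in `S` code. -/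
def codedVectors (u : ℕ) (S : List (List ℕ)) : Set (Fin u → ℕ) :=
  Set.range fun k : Fin S.length => vectorOfList u S[k]

theorem mem_codedVectors {v : Fin u → ℕ} :
    v ∈ codedVectors u S ↔ ∃ s ∈ S, vectorOfList u s = v := by
  simp [codedVectors, List.exists_mem_iff_getElem, Fin.exists_iff]

theorem vectorOfList_ofFn (a : Fin u → ℕ) : vectorOfList u (List.ofFn a) = a := by
  funext i
  simp [vectorOfList]

theorem exists_mem_words_iff {P : (Fin u → ℕ) → Prop} :
    (∃ a ∈ words B u, P (vectorOfList u a)) ↔ ∃ a : Fin u → ℕ, (∀ i, a i < B) ∧ P a := by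
  constructor
  · rintro ⟨a, ha, hP⟩
    obtain ⟨rfl, hlt⟩ := mem_words.mp ha
    exact ⟨_, fun i => by simpa [vectorOfList] using hlt _ (List.getElem_mem i.2), hP⟩
  · rintro ⟨a, ha, hP⟩
    exact ⟨List.ofFn a, mem_words.mpr ⟨by simp, by simpa [List.forall_mem_ofFn_iff] using ha⟩,
      by rwa [vectorOfList_ofFn]⟩

theorem dot_eq_sum (a b : List ℕ) :
    dot u a b = ∑ i, vectorOfList u a i * vectorOfList u b i := by
  simp only [vectorOfList]
  rw [Fin.sum_univ_eq_sum_range fun i => a.getD i 0 * b.getD i 0]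
  rfl

theorem dot_column_eq_sum (a : List ℕ) (i : Fin u) : dot S.length a (column S i) =
    ∑ k : Fin S.length, vectorOfList S.length a k * vectorOfList u S[k] i := by
  rw [dot_eq_sum]
  simp [vectorOfList, column]

theorem separates_eq_true_iff : separates u S r a b = true ↔
    (∀ s ∈ codedVectors u S,
      ∑ i, vectorOfList u a i * s i = ∑ i, vectorOfList u b i * s i) ∧
    ∑ i, vectorOfList u a i * vectorOfList u r i ≠
      ∑ i, vectorOfList u b i * vectorOfList u r i := by
  simp [separates, dot_eq_sum, mem_codedVectors]

theorem expresses_eq_true_iff {D : ℕ} : expresses u S r D a b = true ↔ ∀ i : Fin u,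
    D * vectorOfList u r i + ∑ k : Fin S.length, vectorOfList S.length b k * vectorOfList u S[k] i =
      ∑ k : Fin S.length, vectorOfList S.length a k * vectorOfList u S[k] i := by
  simp only [← dot_column_eq_sum]
  simp [expresses, Fin.forall_iff, vectorOfList]

theorem spansMod_eq_true_iff [NeZero p] : spansMod u R S p = true ↔
    ∀ r ∈ codedVectors u R, castVector (ZMod p) r ∈ castSpan (ZMod p) (codedVectors u S) := by
  have hwords (r : List ℕ) : (∃ c ∈ words p S.length, ∀ i < u,
      dot S.length c (column S i) % p = r.getD i 0 % p) ↔
      ∃ c : Fin S.length → ℕ, (∀ k, c k < p) ∧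
        ∀ i, ∑ k : Fin S.length, c k * vectorOfList u S[k] i ≡ vectorOfList u r i [MOD p] := by
    rw [← exists_mem_words_iff]
    simp only [← dot_column_eq_sum, Fin.forall_iff]
    rfl
  simp only [spansMod, List.all_eq_true, List.any_eq_true, decide_eq_true_eq, List.mem_range,
    hwords, ← mem_castSpan_zmod_iff]
  simp only [mem_codedVectors, forall_exists_index, and_imp, forall_apply_eq_imp_iff₂]
  rfl

theorem separatesSome_eq_true_iff : separatesSome u R S B = true ↔ ∃ r ∈ codedVectors u R,
    ∃ a : Fin u → ℕ, (∀ i, a i < B) ∧ ∃ b : Fin u → ℕ, (∀ i, b i < B) ∧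
      (∀ s ∈ codedVectors u S, ∑ i, a i * s i = ∑ i, b i * s i) ∧
        ∑ i, a i * r i ≠ ∑ i, b i * r i := by
  simp only [← exists_mem_words_iff]
  simp [separatesSome, separates_eq_true_iff, mem_codedVectors]

theorem expressesAll_eq_true_iff : expressesAll u R S B = true ↔ ∀ r ∈ codedVectors u R,
    ∃ D < B, 0 < D ∧ ∃ a : Fin S.length → ℕ, (∀ k, a k < B) ∧
      ∃ b : Fin S.length → ℕ, (∀ k, b k < B) ∧ ∀ i,
        D * r i + ∑ k, b k * vectorOfList u S[k] i = ∑ k, a k * vectorOfList u S[k] i := by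
  simp only [← exists_mem_words_iff]
  simp [expressesAll, expresses_eq_true_iff, mem_codedVectors]

theorem eventually_forall_lt {ι : Type*} [Finite ι] (a : ι → ℕ) :
    ∀ᶠ B in Filter.atTop, ∀ i, a i < B :=
  Filter.eventually_all.mpr fun i => Filter.eventually_gt_atTop (a i)

theorem eventually_separatesSome {r : Fin u → ℕ} (hr : r ∈ codedVectors u R)
    (h : castVector ℚ r ∉ castSpan ℚ (codedVectors u S)) :
    ∀ᶠ B in Filter.atTop, separatesSome u R S B = true := by
  obtain ⟨a, b, hab⟩ := exists_separating_of_notMem_castSpan_rat h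
  filter_upwards [eventually_forall_lt a, eventually_forall_lt b] with B ha hb
  exact separatesSome_eq_true_iff.mpr ⟨r, hr, a, ha, b, hb, hab⟩

theorem exists_notMem_of_separatesSome (h : separatesSome u R S B = true) :
    ∃ r ∈ codedVectors u R, castVector ℚ r ∉ castSpan ℚ (codedVectors u S) := by
  obtain ⟨r, hr, a, -, b, -, hab⟩ := separatesSome_eq_true_iff.mp h
  exact ⟨r, hr, notMem_castSpan_rat_iff.mpr ⟨a, b, hab⟩⟩

theorem eventually_expressesAll
    (h : ∀ r ∈ codedVectors u R, castVector ℚ r ∈ castSpan ℚ (codedVectors u S)) :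
    ∀ᶠ B in Filter.atTop, expressesAll u R S B = true := by
  simp only [expressesAll_eq_true_iff]
  refine (Filter.eventually_all_finite (Set.finite_range _)).mpr fun r hr => ?_
  obtain ⟨D, hD, a, b, hab⟩ := mem_castSpan_rat_iff.mp (h r hr)
  filter_upwards [Filter.eventually_gt_atTop D, eventually_forall_lt a, eventually_forall_lt b]
    with B hDB ha hb
  exact ⟨D, hDB, Nat.pos_of_ne_zero hD, a, ha, b, hb, hab⟩

theorem mem_castSpan_of_expressesAll (h : expressesAll u R S B = true) {K : Type*} [Field K]
    (hK : ∀ D < B, 0 < D → (D : K) ≠ 0) {r : Fin u → ℕ} (hr : r ∈ codedVectors u R) :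
    castVector K r ∈ castSpan K (codedVectors u S) := by
  obtain ⟨D, hDB, hD, a, -, b, -, hab⟩ := expressesAll_eq_true_iff.mp h r hr
  exact mem_castSpan_of_natCast_ne_zero hab (hK D hDB hD)

/-- The correct outcomes of the algorithm `exceptionalPrimes`. -/
def IsExceptionalPrimes (R S : Set (Fin u → ℕ)) (out : Option (List ℕ)) : Prop :=
  (out = none ∧ ¬∀ r ∈ R, castVector ℚ r ∈ castSpan ℚ S) ∨
    ∃ P, out = some P ∧ (∀ r ∈ R, castVector ℚ r ∈ castSpan ℚ S) ∧
      ∀ p, p ∈ P ↔ p.Prime ∧ ¬∀ r ∈ R, castVector (ZMod p) r ∈ castSpan (ZMod p) S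

theorem mem_filter_primes_iff_of_expressesAll (h : expressesAll u R S B = true) :
    p ∈ ((List.range B).filter fun p => decide p.Prime && !spansMod u R S p) ↔ p.Prime ∧
      ¬∀ r ∈ codedVectors u R,
        castVector (ZMod p) r ∈ castSpan (ZMod p) (codedVectors u S) := by
  simp only [List.mem_filter, List.mem_range, Bool.and_eq_true, decide_eq_true_eq,
    Bool.not_eq_true', ← Bool.not_eq_true]
  by_cases hp : p.Prime
  swap
  · simp only [hp, false_and, and_false]
  have : Fact p.Prime := ⟨hp⟩
  have hlt (hR : ¬∀ r ∈ codedVectors u R,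
      castVector (ZMod p) r ∈ castSpan (ZMod p) (codedVectors u S)) : p < B := by
    contrapose! hR
    refine fun r hr => mem_castSpan_of_expressesAll h (fun D hDB hD hzero => ?_) hr
    exact absurd (Nat.le_of_dvd hD ((ZMod.natCast_eq_zero_iff D p).mp hzero)) (by omega)
  rw [spansMod_eq_true_iff]
  exact ⟨fun H => H.2, fun H => ⟨hlt H.2, H⟩⟩

theorem isExceptionalPrimes_of_mem_search {out : Option (List ℕ)}
    (h : out ∈ searchExceptionalPrimes u R S B) :
    IsExceptionalPrimes (codedVectors u R) (codedVectors u S) out := by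
  rw [searchExceptionalPrimes] at h
  cases hsep : separatesSome u R S B with
  | true =>
    obtain ⟨r, hr, hnot⟩ := exists_notMem_of_separatesSome hsep
    rw [hsep, cond_true, Option.mem_some_iff] at h
    exact .inl ⟨h.symm, fun H => hnot (H r hr)⟩
  | false =>
    cases hexp : expressesAll u R S B with
    | true =>
      rw [hsep, hexp, cond_false, cond_true, Option.mem_some_iff] at h
      exact .inr ⟨_, h.symm, fun r => mem_castSpan_of_expressesAll hexp
        (fun D _ hD => Nat.cast_ne_zero.mpr hD.ne'),
        fun p => mem_filter_primes_iff_of_expressesAll hexp⟩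
    | false => simp [hsep, hexp] at h

theorem exists_mem_exceptionalPrimes (u : ℕ) (R S : List (List ℕ)) :
    ∃ out ∈ exceptionalPrimes (u, R, S),
      IsExceptionalPrimes (codedVectors u R) (codedVectors u S) out := by
  have hfound : ∃ B out, out ∈ searchExceptionalPrimes u R S B := by
    by_cases h : ∀ r ∈ codedVectors u R, castVector ℚ r ∈ castSpan ℚ (codedVectors u S)
    · obtain ⟨B, hB⟩ := (eventually_expressesAll h).exists
      cases hsep : separatesSome u R S B <;> exact ⟨B, by simp [searchExceptionalPrimes, hB, hsep]⟩
    · push Not at h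
      obtain ⟨r, hr, hnot⟩ := h
      obtain ⟨B, hB⟩ := (eventually_separatesSome hr hnot).exists
      exact ⟨B, none, by simp [searchExceptionalPrimes, hB]⟩
  have hdom := Nat.rfindOpt_dom.mpr hfound
  obtain ⟨B, hB⟩ := Nat.rfindOpt_spec (Part.get_mem hdom)
  exact ⟨_, Part.get_mem hdom, isExceptionalPrimes_of_mem_search hB⟩

end Correctness

end ExceptionalPrimes

section Programs

/-- The part of a state diagram that lists, for each state and letter, the image of the letter and
the section. -/
abbrev Table := List (List (ℕ × ℕ))

/-- The code of the identity. The state with number `i` has the code `2 * i`, and its inverse has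
the code `2 * i + 1`. -/
def identityCode (t : Table) : ℕ := 2 * t.length

/-- The letter that a state sends to `x`, if `l` is the row of that state. -/
def preimage (l : List (ℕ × ℕ)) (x : ℕ) : ℕ := l.findIdx fun e => decide (e.1 = x)

/-- The image of the letter `x` under the group element with code `c`, and the section at `x`. -/
def step (t : Table) (c x : ℕ) : ℕ × ℕ :=
  bif decide (c < identityCode t) then
    bif decide (c % 2 = 0) then
      (((t.getD (c / 2) []).getD x (0, 0)).1, 2 * ((t.getD (c / 2) []).getD x (0, 0)).2)
    else
      (preimage (t.getD (c / 2) []) x,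
        2 * ((t.getD (c / 2) []).getD (preimage (t.getD (c / 2) []) x) (0, 0)).2 + 1)
  else (x, c)

/-- The image of a letter under a product of coded group elements, and the section there. -/
def stepProduct (t : Table) (u : List ℕ) (x : ℕ) : ℕ × List ℕ :=
  u.foldr (fun c s => ((step t c s.1).1, (step t c s.1).2 :: s.2)) (x, [])

/-- The image of a word under a product of coded group elements, and the section there. -/
def act (t : Table) : List ℕ → List ℕ → List ℕ × List ℕ
  | u, [] => ([], u)
  | u, x :: w =>
    ((stepProduct t u x).1 :: (act t (stepProduct t u x).2 w).1, (act t (stepProduct t u x).2 w).2)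

/-- The products of `m` coded group elements. -/
def products (t : Table) (m : ℕ) : List (List ℕ) := words (identityCode t + 1) m

/-- The products `u` and `v` agree on the words of length `k` over `d` letters. -/
def agree (t : Table) (d k : ℕ) (u v : List ℕ) : Bool :=
  (words d k).all fun w => decide ((act t u w).1 = (act t v w).1)

/-- Products of `m` elements which agree on the words of length `k` agree on those of length
`k + 1`. Hence they are equal. -/
def detectsEquality (t : Table) (d k m : ℕ) : Bool :=
  (products t m).all fun u => (products t m).all fun v =>
    !agree t d k u v || agree t d (k + 1) u v

/-- The sections of products of `m + 1` elements at words of length `n` are products of `m`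
elements. They are padded by the identity since `k` is meant for products of `m + 1` elements. -/
def contracts (t : Table) (d k m n : ℕ) : Bool :=
  (products t (m + 1)).all fun u => (words d n).all fun w => (products t m).any fun v =>
    agree t d k (act t u w).2 (identityCode t :: v)

/-- The products `u` and `v` have the same image of `w`. -/
def sameImage (t : Table) (w u v : List ℕ) : Bool := decide ((act t u w).1 = (act t v w).1)

/-- The products `u` and `v` have the same section at `w`. -/
def sameSection (t : Table) (d k : ℕ) (w u v : List ℕ) : Bool :=
  agree t d k (act t u w).2 (act t v w).2

/-- The family of the products of `m` elements has the same state at `w` and at `w'`. -/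
def sameState (t : Table) (d k m : ℕ) (w w' : List ℕ) : Bool :=
  (products t m).all fun u => agree t d k (act t u w).2 (act t u w').2 &&
    (products t m).all fun v => decide (sameImage t w u v = sameImage t w' u v)

/-- Every word in `W` has the same state as some word in `W'`. -/
def coversStates (t : Table) (d k m : ℕ) (W W' : List (List ℕ)) : Bool :=
  W.all fun w => W'.any fun w' => sameState t d k m w w'

/-- The family of the products of `m` elements is resolved by `w`. -/
def resolves (t : Table) (d k m : ℕ) (w : List ℕ) : Bool :=
  (products t m).all fun u => (products t m).all fun v =>
    !sameImage t w u v || sameSection t d k w u v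

/-- The class vectors of the products of `m` elements at the words in `W`. -/
def classRows (t : Table) (d k m : ℕ) (W : List (List ℕ)) : List (List ℕ) :=
  W.flatMap fun w => (products t m).map fun u => (products t m).map fun v =>
    bif sameImage t w v u && sameSection t d k w v u then 1 else 0

/-- The resolving words shorter than `n`. -/
def shortResolvingWords (t : Table) (d k m n : ℕ) : List (List ℕ) :=
  ((List.range n).flatMap fun l => words d l).filter fun w => resolves t d k m w

/-- The parameters `k`, `m`, `n`, `a`, `b` of the reduction to linear algebra: words of length `k`
detect equality of products of `m + 1` elements, sections at words of length `n` reduce these to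
products of `m` elements, and the states of the latter at the words of length `a` and `b` are the
same. -/
abbrev Parameters := ℕ × ℕ × ℕ × ℕ × ℕ

/-- The test whether the parameters have the required properties. -/
def isAdequate (q : ℕ × Table) : Parameters → Bool
  | (k, m, n, a, b) => detectsEquality q.2 q.1 k (m + 1) && contracts q.2 q.1 k m n &&
      decide (a < b) && coversStates q.2 q.1 k m (words q.1 a) (words q.1 b) &&
        coversStates q.2 q.1 k m (words q.1 b) (words q.1 a)

/-- The search for adequate parameters. -/
def findParameters (q : ℕ × Table) : Part Parameters :=
  Nat.rfindOpt fun j => bif isAdequate q (Denumerable.ofNat Parameters j) then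
    some (Denumerable.ofNat Parameters j) else none

/-- The length of the class vectors, those at the words of length `a`, and those at the resolving
words shorter than `b`. -/
def linearProblem (q : ℕ × Table) : Parameters → ℕ × List (List ℕ) × List (List ℕ)
  | (k, m, _, a, b) => ((products q.2 m).length, classRows q.2 q.1 k m (words q.1 a),
      classRows q.2 q.1 k m (shortResolvingWords q.2 q.1 k m b))

/-- The algorithm that finds the characteristics over which the Nekrashevych algebra is not simple,
if it is simple in characteristic zero. The input is a state diagram. -/
def decideSimplicity (q : ℕ × Table) : Part (Option (List ℕ)) :=
  (findParameters q).bind fun c => exceptionalPrimes (linearProblem q c)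

section Primrec

variable {α : Type*} [Primcodable α] {t : α → Table} {d k m n c x : α → ℕ} {u v w w' : α → List ℕ}
  {W W' : α → List (List ℕ)}

@[fun_prop]
theorem primrec_identityCode (ht : Primrec t) : Primrec fun s => identityCode (t s) := by
  unfold identityCode
  fun_prop

@[fun_prop]
theorem primrec_preimage {l : α → List (ℕ × ℕ)} (hl : Primrec l) (hx : Primrec x) :
    Primrec fun s => preimage (l s) (x s) := by
  unfold preimage
  fun_prop

@[fun_prop]
theorem primrec_step (ht : Primrec t) (hc : Primrec c) (hx : Primrec x) :
    Primrec fun s => step (t s) (c s) (x s) := by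
  unfold step
  fun_prop

@[fun_prop]
theorem primrec_stepProduct (ht : Primrec t) (hu : Primrec u) (hx : Primrec x) :
    Primrec fun s => stepProduct (t s) (u s) (x s) := by
  unfold stepProduct
  fun_prop

theorem foldl_stepProduct (t : Table) (u w z : List ℕ) :
    w.foldl (fun s x => ((stepProduct t s.2 x).1 :: s.1, (stepProduct t s.2 x).2)) (z, u) =
      ((act t u w).1.reverse ++ z, (act t u w).2) := by
  induction w generalizing u z with
  | nil => rfl
  | cons x w ih => simp [act, ih]

@[fun_prop]
theorem primrec_act (ht : Primrec t) (hu : Primrec u) (hw : Primrec w) :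
    Primrec fun s => act (t s) (u s) (w s) := by
  have h : Primrec fun s => (w s).foldl
      (fun p x => ((stepProduct (t s) p.2 x).1 :: p.1, (stepProduct (t s) p.2 x).2))
      ([], u s) := by fun_prop
  refine ((Primrec.list_reverse.comp (Primrec.fst.comp h)).pair (Primrec.snd.comp h)).of_eq
    fun s => ?_
  simp [foldl_stepProduct]

@[fun_prop]
theorem primrec_products (ht : Primrec t) (hm : Primrec m) :
    Primrec fun s => products (t s) (m s) := by
  unfold products
  fun_prop

@[fun_prop]
theorem primrec_agree (ht : Primrec t) (hd : Primrec d) (hk : Primrec k) (hu : Primrec u)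
    (hv : Primrec v) : Primrec fun s => agree (t s) (d s) (k s) (u s) (v s) := by
  unfold agree
  fun_prop

@[fun_prop]
theorem primrec_detectsEquality (ht : Primrec t) (hd : Primrec d) (hk : Primrec k)
    (hm : Primrec m) : Primrec fun s => detectsEquality (t s) (d s) (k s) (m s) := by
  unfold detectsEquality
  fun_prop

@[fun_prop]
theorem primrec_contracts (ht : Primrec t) (hd : Primrec d) (hk : Primrec k) (hm : Primrec m)
    (hn : Primrec n) : Primrec fun s => contracts (t s) (d s) (k s) (m s) (n s) := by
  unfold contracts
  fun_prop

@[fun_prop]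
theorem primrec_sameImage (ht : Primrec t) (hw : Primrec w) (hu : Primrec u) (hv : Primrec v) :
    Primrec fun s => sameImage (t s) (w s) (u s) (v s) := by
  unfold sameImage
  fun_prop

@[fun_prop]
theorem primrec_sameSection (ht : Primrec t) (hd : Primrec d) (hk : Primrec k) (hw : Primrec w)
    (hu : Primrec u) (hv : Primrec v) :
    Primrec fun s => sameSection (t s) (d s) (k s) (w s) (u s) (v s) := by
  unfold sameSection
  fun_prop

@[fun_prop]
theorem primrec_sameState (ht : Primrec t) (hd : Primrec d) (hk : Primrec k) (hm : Primrec m)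
    (hw : Primrec w) (hw' : Primrec w') :
    Primrec fun s => sameState (t s) (d s) (k s) (m s) (w s) (w' s) := by
  unfold sameState
  fun_prop

@[fun_prop]
theorem primrec_coversStates (ht : Primrec t) (hd : Primrec d) (hk : Primrec k) (hm : Primrec m)
    (hW : Primrec W) (hW' : Primrec W') :
    Primrec fun s => coversStates (t s) (d s) (k s) (m s) (W s) (W' s) := by
  unfold coversStates
  fun_prop

@[fun_prop]
theorem primrec_resolves (ht : Primrec t) (hd : Primrec d) (hk : Primrec k) (hm : Primrec m)
    (hw : Primrec w) : Primrec fun s => resolves (t s) (d s) (k s) (m s) (w s) := by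
  unfold resolves
  fun_prop

@[fun_prop]
theorem primrec_classRows (ht : Primrec t) (hd : Primrec d) (hk : Primrec k) (hm : Primrec m)
    (hW : Primrec W) : Primrec fun s => classRows (t s) (d s) (k s) (m s) (W s) := by
  unfold classRows
  fun_prop

@[fun_prop]
theorem primrec_shortResolvingWords (ht : Primrec t) (hd : Primrec d) (hk : Primrec k)
    (hm : Primrec m) (hn : Primrec n) :
    Primrec fun s => shortResolvingWords (t s) (d s) (k s) (m s) (n s) := by
  unfold shortResolvingWords
  fun_prop

@[fun_prop]
theorem primrec_isAdequate {q : α → ℕ × Table} {c : α → Parameters} (hq : Primrec q)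
    (hc : Primrec c) : Primrec fun s => isAdequate (q s) (c s) := by
  unfold isAdequate
  fun_prop

theorem partrec_findParameters : Partrec findParameters := by
  have hdecode : Primrec fun s : (ℕ × Table) × ℕ => Denumerable.ofNat Parameters s.2 :=
    (Primrec.ofNat Parameters).comp Primrec.snd
  have h : Primrec fun s : (ℕ × Table) × ℕ =>
      bif isAdequate s.1 (Denumerable.ofNat Parameters s.2) then
        some (Denumerable.ofNat Parameters s.2) else none := by fun_prop
  exact Partrec.rfindOpt h.to_comp

theorem primrec_linearProblem :
    Primrec fun s : (ℕ × Table) × Parameters => linearProblem s.1 s.2 := by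
  unfold linearProblem
  fun_prop

theorem partrec_decideSimplicity : Partrec decideSimplicity :=
  partrec_findParameters.bind (partrec_exceptionalPrimes.comp primrec_linearProblem.to_comp)

end Primrec

end Programs

section Coding

open scoped Pointwise

variable {G X : Type*} [Group G] [MulAction G (List X)] [SelfSimilarGroup G X]

theorem sectWord_mem {S : Set G} (hS : ∀ a ∈ S, ∀ x : X, sect a x ∈ S) {g : G} (hg : g ∈ S)
    (w : List X) : sectWord g w ∈ S := by
  induction w generalizing g with
  | nil => exact hg
  | cons x _ ih => exact ih (hS g hg x)

theorem sect_mem_pow {S : Set G} (hS : ∀ a ∈ S, ∀ x : X, sect a x ∈ S) {m : ℕ} {g : G}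
    (hg : g ∈ S ^ m) (x : X) : sect g x ∈ S ^ m := by
  induction m generalizing g x with
  | zero =>
    obtain rfl : g = 1 := by simpa using hg
    simpa using sect_one x
  | succ m ih =>
    rw [pow_succ] at hg ⊢
    obtain ⟨a, ha, b, hb, rfl⟩ := Set.mem_mul.mp hg
    rw [sect_mul]
    exact Set.mul_mem_mul (ih ha _) (hS b hb x)

theorem exists_sectWord_mem_pow {S : Set G} (hS : ∀ a ∈ S, ∀ x : X, sect a x ∈ S) {m n : ℕ}
    (h : ∀ g ∈ S ^ (m + 1), ∀ w : List X, w.length = n → sectWord g w ∈ S ^ m) (r : ℕ) :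
    ∃ N, ∀ g ∈ S ^ (m + r), ∀ w : List X, N ≤ w.length → sectWord g w ∈ S ^ m := by
  induction r with
  | zero => exact ⟨0, fun g hg w _ => sectWord_mem (fun _ => sect_mem_pow hS) hg w⟩
  | succ r ih =>
    obtain ⟨N, hN⟩ := ih
    refine ⟨n + N, fun g hg w hw => ?_⟩
    rw [add_comm r, ← add_assoc, pow_add] at hg
    obtain ⟨a, ha, b, hb, rfl⟩ := Set.mem_mul.mp hg
    have htake : sectWord (a * b) (w.take n) ∈ S ^ (m + r) := by
      rw [sectWord_mul, pow_add]
      exact Set.mul_mem_mul (h a ha _ (by simp [length_smul]; omega))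
        (sectWord_mem (fun _ => sect_mem_pow hS) hb _)
    simpa only [← sectWord_append, List.take_append_drop] using
      hN _ htake (w.drop n) (by simp; omega)

theorem smul_eq_smul_of_length_le {g h : G} {k : ℕ}
    (H : ∀ z : List X, z.length = k → g • z = h • z) {z : List X} (hz : z.length ≤ k) :
    g • z = h • z := by
  cases z with
  | nil => rw [smul_nil, smul_nil]
  | cons x z =>
    have hpad := H (x :: z ++ List.replicate (k - (x :: z).length) x) (by simp at hz ⊢; omega)
    rw [smul_append, smul_append] at hpad
    exact (List.append_inj' hpad (by simp [length_smul])).1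

theorem exists_mem_findParameters {q : ℕ × Table} (h : ∃ c, isAdequate q c = true) :
    ∃ c ∈ findParameters q, isAdequate q c = true := by
  obtain ⟨c, hc⟩ := h
  have hdom : (findParameters q).Dom :=
    Nat.rfindOpt_dom.mpr ⟨Encodable.encode c, c, by
      rw [Denumerable.ofNat_encode, hc]
      rfl⟩
  obtain ⟨j, hj⟩ := Nat.rfindOpt_spec (Part.get_mem hdom)
  refine ⟨_, Part.get_mem hdom, ?_⟩
  by_contra hnot
  grind

/-- The group element that a list of codes stands for. -/
def value (s : ℕ → G) (u : List ℕ) : G := (u.map s).prod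

/-- The table `t` describes the action of `G` on the words over `X`, where the letters have the
codes `0, …, d - 1`, the letter with code `x` is `l x`, and the group element with code `c` is
`s c`. -/
structure IsCoding (t : Table) (d : ℕ) (l : ℕ → X) (s : ℕ → G) : Prop where
  bijOn_letter : Set.BijOn l (Set.Iio d) Set.univ
  step_mem {c x : ℕ} : c ≤ identityCode t → x < d →
    (step t c x).1 < d ∧ (step t c x).2 ≤ identityCode t
  letter_step {c x : ℕ} : c ≤ identityCode t → x < d → l (step t c x).1 = letter (s c) (l x)
  sect_step {c x : ℕ} : c ≤ identityCode t → x < d → s (step t c x).2 = sect (s c) (l x)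
  identityCode_eq_one : s (identityCode t) = 1
  exists_value_eq (g : G) : ∃ m, ∃ u ∈ products t m, value s u = g

namespace IsCoding

variable {t : Table} {d : ℕ} {l : ℕ → X} {s : ℕ → G} {k m n : ℕ} {u v w : List ℕ}

theorem stepProduct_mem (hI : IsCoding t d l s) (hu : u ∈ products t m) {x : ℕ} (hx : x < d) :
    (stepProduct t u x).1 < d ∧ (stepProduct t u x).2 ∈ products t m := by
  induction m generalizing u with
  | zero =>
    obtain rfl : u = [] := by simpa [products, words] using hu
    exact ⟨hx, hu⟩
  | succ m ih =>
    obtain ⟨c, hc, v, hv, rfl⟩ := mem_words_succ.mp hu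
    obtain ⟨hletter, hsect⟩ := ih hv
    obtain ⟨hletter', hsect'⟩ := hI.step_mem (Nat.le_of_lt_succ hc) hletter
    exact ⟨hletter', mem_words_succ.mpr ⟨_, Nat.lt_succ_of_le hsect', _, hsect, rfl⟩⟩

theorem value_cons (c : ℕ) (u : List ℕ) : value s (c :: u) = s c * value s u := by
  simp [value]

theorem value_stepProduct (hI : IsCoding t d l s) (hu : u ∈ products t m) {x : ℕ}
    (hx : x < d) : l (stepProduct t u x).1 = letter (value s u) (l x) ∧
      value s (stepProduct t u x).2 = sect (value s u) (l x) := by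
  induction m generalizing u with
  | zero =>
    obtain rfl : u = [] := by simpa [products, words] using hu
    exact ⟨(letter_one (G := G) (l x)).symm, (sect_one (G := G) (l x)).symm⟩
  | succ m ih =>
    obtain ⟨c, hc, v, hv, rfl⟩ := mem_words_succ.mp hu
    have hc : c ≤ identityCode t := Nat.le_of_lt_succ hc
    have hx' := (hI.stepProduct_mem hv hx).1
    rw [value_cons, letter_mul, sect_mul, ← (ih hv).1, ← (ih hv).2, ← hI.letter_step hc hx',
      ← hI.sect_step hc hx']
    exact ⟨rfl, value_cons _ _⟩

theorem act_mem (hI : IsCoding t d l s) (hu : u ∈ products t m) (hw : w ∈ words d n) :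
    (act t u w).1 ∈ words d n ∧ (act t u w).2 ∈ products t m := by
  induction n generalizing u w with
  | zero =>
    obtain rfl : w = [] := by simpa [words] using hw
    exact ⟨hw, hu⟩
  | succ n ih =>
    obtain ⟨x, hx, v, hv, rfl⟩ := mem_words_succ.mp hw
    obtain ⟨hletter, hsect⟩ := hI.stepProduct_mem hu hx
    exact ⟨mem_words_succ.mpr ⟨_, hletter, _, (ih hsect hv).1, rfl⟩, (ih hsect hv).2⟩

theorem value_act (hI : IsCoding t d l s) (hu : u ∈ products t m) (hw : w ∈ words d n) :
    (act t u w).1.map l = value s u • w.map l ∧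
      value s (act t u w).2 = sectWord (value s u) (w.map l) := by
  induction n generalizing u w with
  | zero =>
    obtain rfl : w = [] := by simpa [words] using hw
    exact ⟨(smul_nil _).symm, rfl⟩
  | succ n ih =>
    obtain ⟨x, hx, v, hv, rfl⟩ := mem_words_succ.mp hw
    obtain ⟨hletter, hsect⟩ := hI.value_stepProduct hu hx
    obtain ⟨himage, hsection⟩ := ih (hI.stepProduct_mem hu hx).2 hv
    rw [List.map_cons, smul_cons, sectWord, ← hletter, ← hsect, ← himage, ← hsection]
    exact ⟨rfl, rfl⟩

theorem bijOn_map_words (hI : IsCoding t d l s) (n : ℕ) :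
    Set.BijOn (List.map l) {w | w ∈ words d n} {z | z.length = n} := by
  refine ⟨fun w hw => by simpa using (mem_words.mp hw).1, ?_, ?_⟩
  · induction n with
    | zero => exact fun v hv _ hw _ => by simp_all [words]
    | succ n ih =>
      rintro v hv w hw h
      obtain ⟨x, hx, v', hv', rfl⟩ := mem_words_succ.mp hv
      obtain ⟨y, hy, w', hw', rfl⟩ := mem_words_succ.mp hw
      obtain ⟨hxy, hvw⟩ := List.cons.inj h
      rw [hI.bijOn_letter.injOn hx hy hxy, ih hv' hw' hvw]
  · induction n with
    | zero => exact fun z hz => ⟨[], by simp [words], (List.length_eq_zero_iff.mp hz).symm⟩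
    | succ n ih =>
      intro z hz
      obtain ⟨y, z, rfl⟩ := List.exists_cons_of_length_eq_add_one hz
      obtain ⟨x, hx, rfl⟩ := hI.bijOn_letter.surjOn (Set.mem_univ y)
      obtain ⟨w, hw, rfl⟩ := ih (Nat.succ_injective hz)
      exact ⟨x :: w, mem_words_succ.mpr ⟨x, hx, w, hw, rfl⟩, rfl⟩

theorem forall_length_eq_iff (hI : IsCoding t d l s) {p : List X → Prop} :
    (∀ z, z.length = n → p z) ↔ ∀ w ∈ words d n, p (w.map l) := by
  have h : (∀ z ∈ List.map l '' {w | w ∈ words d n}, p z) ↔ _ := Set.forall_mem_image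
  rw [(hI.bijOn_map_words n).image_eq] at h
  exact h

theorem act_fst_eq_iff (hI : IsCoding t d l s) (hu : u ∈ products t m) (hv : v ∈ products t m)
    (hw : w ∈ words d n) :
    (act t u w).1 = (act t v w).1 ↔ value s u • w.map l = value s v • w.map l := by
  rw [← (hI.value_act hu hw).1, ← (hI.value_act hv hw).1]
  exact ((hI.bijOn_map_words n).injOn.eq_iff (hI.act_mem hu hw).1 (hI.act_mem hv hw).1).symm

theorem agree_iff_forall_smul_eq (hI : IsCoding t d l s) (hu : u ∈ products t m)
    (hv : v ∈ products t m) : agree t d k u v = true ↔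
      ∀ z : List X, z.length = k → value s u • z = value s v • z := by
  rw [hI.forall_length_eq_iff, agree, List.all_eq_true]
  exact forall₂_congr fun w hw => decide_eq_true_iff.trans (hI.act_fst_eq_iff hu hv hw)

theorem value_eq_of_agree (hI : IsCoding t d l s) (hk : detectsEquality t d k m = true)
    (hu : u ∈ products t m) (hv : v ∈ products t m) (h : agree t d k u v = true) :
    value s u = value s v := by
  refine eq_of_forall_smul_eq X fun z => ?_
  induction z generalizing u v with
  | nil => rw [smul_nil, smul_nil]
  | cons y z ih =>
    obtain ⟨x, hx, rfl⟩ := hI.bijOn_letter.surjOn (Set.mem_univ y)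
    have hagree : agree t d (k + 1) u v = true := by
      simp only [detectsEquality, List.all_eq_true] at hk
      simpa [h] using hk u hu v hv
    have hcons (z : List X) (hz : z.length = k) :
        letter (value s u) (l x) = letter (value s v) (l x) ∧
          sect (value s u) (l x) • z = sect (value s v) (l x) • z := by
      have := (hI.agree_iff_forall_smul_eq hu hv).mp hagree (l x :: z) (by simpa using hz)
      simpa only [smul_cons, List.cons.injEq] using this
    have hsect := ih (hI.stepProduct_mem hu hx).2 (hI.stepProduct_mem hv hx).2 <|
      (hI.agree_iff_forall_smul_eq (hI.stepProduct_mem hu hx).2 (hI.stepProduct_mem hv hx).2).mpr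
        fun z hz => by
          rw [(hI.value_stepProduct hu hx).2, (hI.value_stepProduct hv hx).2, (hcons z hz).2]
    rw [(hI.value_stepProduct hu hx).2, (hI.value_stepProduct hv hx).2] at hsect
    rw [smul_cons, smul_cons, hsect, (hcons (List.replicate k (l x)) (by simp)).1]

theorem identityCode_cons_mem (hu : u ∈ products t m) :
    identityCode t :: u ∈ products t (m + 1) :=
  mem_words_succ.mpr ⟨_, Nat.lt_succ_self _, u, hu, rfl⟩

theorem value_identityCode_cons (hI : IsCoding t d l s) (u : List ℕ) :
    value s (identityCode t :: u) = value s u := by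
  rw [value_cons, hI.identityCode_eq_one, one_mul]

theorem agree_iff_value_eq (hI : IsCoding t d l s) (hk : detectsEquality t d k (m + 1) = true)
    (hu : u ∈ products t m) (hv : v ∈ products t m) :
    agree t d k u v = true ↔ value s u = value s v := by
  rw [hI.agree_iff_forall_smul_eq hu hv]
  refine ⟨fun h => ?_, fun h z _ => by rw [h]⟩
  simp only [← hI.value_identityCode_cons u, ← hI.value_identityCode_cons v] at h ⊢
  have hu' := identityCode_cons_mem hu
  have hv' := identityCode_cons_mem hv
  exact hI.value_eq_of_agree hk hu' hv' ((hI.agree_iff_forall_smul_eq hu' hv').mpr h)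

theorem exists_detectsEquality (hI : IsCoding t d l s) (m : ℕ) :
    ∃ k, detectsEquality t d k m = true := by
  have hpair (u : List ℕ) (hu : u ∈ products t m) (v : List ℕ) (hv : v ∈ products t m) :
      ∀ᶠ k in Filter.atTop, agree t d k u v = true → agree t d (k + 1) u v = true := by
    simp only [hI.agree_iff_forall_smul_eq hu hv]
    by_cases h : value s u = value s v
    · exact .of_forall fun k _ z _ => by rw [h]
    · obtain ⟨z, hz⟩ : ∃ z : List X, value s u • z ≠ value s v • z := by
        contrapose! h
        exact eq_of_forall_smul_eq X h
      exact (Filter.eventually_ge_atTop z.length).mono fun k hk H =>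
        absurd (smul_eq_smul_of_length_le H hk) hz
  have hfin : {u | u ∈ products t m}.Finite := List.finite_toSet _
  obtain ⟨k, hk⟩ := ((Filter.eventually_all_finite hfin).mpr fun u hu =>
    (Filter.eventually_all_finite hfin).mpr (hpair u hu)).exists
  refine ⟨k, ?_⟩
  simp only [detectsEquality, List.all_eq_true, Bool.or_eq_true, Bool.not_eq_true']
  exact fun u hu v hv => (Bool.eq_false_or_eq_true _).symm.imp_right (hk u hu v hv)

theorem mem_pow_iff {g : G} :
    g ∈ (s '' Set.Iic (identityCode t)) ^ m ↔ ∃ u ∈ products t m, value s u = g := by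
  induction m generalizing g with
  | zero => simp [products, words, value, eq_comm]
  | succ m ih =>
    rw [pow_succ', Set.mem_mul]
    constructor
    · rintro ⟨_, ⟨c, hc, rfl⟩, b, hb, rfl⟩
      obtain ⟨u, hu, rfl⟩ := ih.mp hb
      exact ⟨c :: u, mem_words_succ.mpr ⟨c, Nat.lt_succ_of_le hc, u, hu, rfl⟩, value_cons c u⟩
    · rintro ⟨u, hu, rfl⟩
      obtain ⟨c, hc, v, hv, rfl⟩ := mem_words_succ.mp hu
      exact ⟨s c, ⟨c, Nat.le_of_lt_succ hc, rfl⟩, value s v, ih.mpr ⟨v, hv, rfl⟩,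
        (value_cons c v).symm⟩

theorem one_mem_image (hI : IsCoding t d l s) : (1 : G) ∈ s '' Set.Iic (identityCode t) :=
  ⟨identityCode t, Set.mem_Iic.mpr le_rfl, hI.identityCode_eq_one⟩

theorem sect_mem_image (hI : IsCoding t d l s) {g : G} (hg : g ∈ s '' Set.Iic (identityCode t))
    (y : X) : sect g y ∈ s '' Set.Iic (identityCode t) := by
  obtain ⟨c, hc, rfl⟩ := hg
  obtain ⟨x, hx, rfl⟩ := hI.bijOn_letter.surjOn (Set.mem_univ y)
  exact ⟨_, (hI.step_mem hc hx).2, hI.sect_step hc hx⟩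

theorem eventually_mem_pow (hI : IsCoding t d l s) (g : G) :
    ∀ᶠ m in Filter.atTop, g ∈ (s '' Set.Iic (identityCode t)) ^ m := by
  obtain ⟨m, hm⟩ := hI.exists_value_eq g
  exact (Filter.eventually_ge_atTop m).mono fun n hn =>
    Set.pow_subset_pow_right hI.one_mem_image hn (mem_pow_iff.mpr hm)

theorem sectWord_mem_pow_of_contracts (hI : IsCoding t d l s)
    (hk : detectsEquality t d k (m + 1) = true) (hn : contracts t d k m n = true) {g : G}
    (hg : g ∈ (s '' Set.Iic (identityCode t)) ^ (m + 1)) (z : List X) (hz : z.length = n) :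
    sectWord g z ∈ (s '' Set.Iic (identityCode t)) ^ m := by
  obtain ⟨u, hu, rfl⟩ := mem_pow_iff.mp hg
  obtain ⟨w, hw, rfl⟩ := (hI.bijOn_map_words n).surjOn hz
  simp only [contracts, List.all_eq_true, List.any_eq_true] at hn
  obtain ⟨v, hv, hagree⟩ := hn u hu w hw
  refine mem_pow_iff.mpr ⟨v, hv, ?_⟩
  rw [← (hI.value_act hu hw).2, ← hI.value_identityCode_cons v]
  exact (hI.value_eq_of_agree hk (hI.act_mem hu hw).2 (identityCode_cons_mem hv) hagree).symm

theorem contracts_of_forall_mem_pow (hI : IsCoding t d l s)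
    (h : ∀ u ∈ products t (m + 1), ∀ z : List X, n ≤ z.length →
      sectWord (value s u) z ∈ (s '' Set.Iic (identityCode t)) ^ m) (k : ℕ) :
    contracts t d k m n = true := by
  simp only [contracts, List.all_eq_true, List.any_eq_true]
  intro u hu w hw
  obtain ⟨v, hv, hvalue⟩ := mem_pow_iff.mp (h u hu (w.map l) (by simp [(mem_words.mp hw).1]))
  refine ⟨v, hv, (hI.agree_iff_forall_smul_eq (hI.act_mem hu hw).2
    (identityCode_cons_mem hv)).mpr fun z _ => ?_⟩
  rw [hI.value_identityCode_cons, hvalue, (hI.value_act hu hw).2]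

theorem exists_contracts (hI : IsCoding t d l s) [Finite X] (hcon : IsContracting G X) :
    ∃ m, ∀ k, ∃ n, contracts t d k m n = true := by
  obtain ⟨N, hN⟩ := hcon.exists_contractsTo
  obtain ⟨m, hm⟩ := ((Filter.eventually_all_finite N.finite_toSet).mpr fun g _ =>
    hI.eventually_mem_pow g).exists
  have hfin : {u | u ∈ products t (m + 1)}.Finite := List.finite_toSet _
  have hsections (u : List ℕ) : ∀ᶠ n in Filter.atTop, ∀ z : List X, n ≤ z.length →
      sectWord (value s u) z ∈ (s '' Set.Iic (identityCode t)) ^ m := by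
    obtain ⟨n, hn⟩ := hN (value s u)
    refine (Filter.eventually_ge_atTop n).mono fun n' hn' z hz => ?_
    obtain ⟨g, hg⟩ := hn z (hn'.trans hz)
    exact hg ▸ hm g g.2
  obtain ⟨n, hn⟩ := ((Filter.eventually_all_finite hfin).mpr fun u _ => hsections u).exists
  exact ⟨m, fun k => ⟨n, hI.contracts_of_forall_mem_pow hn k⟩⟩

/-- The family of the products of `m` coded group elements. -/
def productFamily (t : Table) (s : ℕ → G) (m : ℕ) (i : Fin (products t m).length) : G :=
  value s (products t m)[i]

theorem range_productFamily :
    Set.range (productFamily t s m) = (s '' Set.Iic (identityCode t)) ^ m := by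
  ext g
  simp [mem_pow_iff, productFamily, List.mem_iff_getElem, Fin.exists_iff]

theorem contractsTo_productFamily (hI : IsCoding t d l s)
    (hk : detectsEquality t d k (m + 1) = true) (hn : contracts t d k m n = true) :
    ContractsTo X (productFamily t s m) := by
  intro g
  obtain ⟨r, hr⟩ := (hI.eventually_mem_pow g).exists
  obtain ⟨N, hN⟩ := exists_sectWord_mem_pow (fun _ => hI.sect_mem_image)
    (fun _ => hI.sectWord_mem_pow_of_contracts hk hn) r
  rw [range_productFamily]
  exact ⟨N, hN g (Set.pow_subset_pow_right hI.one_mem_image (Nat.le_add_left r m) hr)⟩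

theorem forall_mem_products {p : List ℕ → Prop} :
    (∀ u ∈ products t m, p u) ↔ ∀ i : Fin (products t m).length, p (products t m)[i] := by
  simp only [List.forall_mem_iff_getElem, Fin.forall_iff, Fin.getElem_fin]

variable {w' : List ℕ} {a b : ℕ}

theorem sameImage_iff (hI : IsCoding t d l s) (hw : w ∈ words d n)
    (i j : Fin (products t m).length) :
    sameImage t w (products t m)[i] (products t m)[j] = true ↔
      productFamily t s m i • w.map l = productFamily t s m j • w.map l :=
  decide_eq_true_iff.trans
    (hI.act_fst_eq_iff (List.getElem_mem i.2) (List.getElem_mem j.2) hw)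

theorem agree_act_iff (hI : IsCoding t d l s) (hk : detectsEquality t d k (m + 1) = true)
    (hw : w ∈ words d a) (hw' : w' ∈ words d b) (i j : Fin (products t m).length) :
    agree t d k (act t (products t m)[i] w).2 (act t (products t m)[j] w').2 = true ↔
      sectWord (productFamily t s m i) (w.map l) = sectWord (productFamily t s m j) (w'.map l) := by
  have hi : (products t m)[i] ∈ products t m := List.getElem_mem i.2
  have hj : (products t m)[j] ∈ products t m := List.getElem_mem j.2
  rw [hI.agree_iff_value_eq hk (hI.act_mem hi hw).2 (hI.act_mem hj hw').2,
    (hI.value_act hi hw).2, (hI.value_act hj hw').2]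
  rfl

theorem sameState_iff (hI : IsCoding t d l s) (hk : detectsEquality t d k (m + 1) = true)
    (hw : w ∈ words d a) (hw' : w' ∈ words d b) : sameState t d k m w w' = true ↔
      wordState (productFamily t s m) (w.map l) = wordState (productFamily t s m) (w'.map l) := by
  have himage (i j : Fin (products t m).length) :
      sameImage t w (products t m)[i] (products t m)[j] =
          sameImage t w' (products t m)[i] (products t m)[j] ↔
        (productFamily t s m i • w.map l = productFamily t s m j • w.map l ↔
          productFamily t s m i • w'.map l = productFamily t s m j • w'.map l) := by
    rw [← hI.sameImage_iff hw, ← hI.sameImage_iff hw', Bool.eq_iff_iff]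
  simp only [sameState, List.all_eq_true, Bool.and_eq_true, decide_eq_true_eq,
    forall_mem_products, himage, hI.agree_act_iff hk hw hw', wordState, Prod.mk.injEq,
    funext_iff, forall_and, eq_iff_iff]

theorem coversStates_iff (hI : IsCoding t d l s) (hk : detectsEquality t d k (m + 1) = true) :
    coversStates t d k m (words d a) (words d b) = true ↔
      wordState (productFamily t s m) '' {z : List X | z.length = a} ⊆
        wordState (productFamily t s m) '' {z : List X | z.length = b} := by
  rw [← (hI.bijOn_map_words a).image_eq, ← (hI.bijOn_map_words b).image_eq, Set.image_image,
    Set.image_image, Set.image_subset_iff, coversStates, List.all_eq_true]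
  refine forall₂_congr fun w hw => ?_
  rw [List.any_eq_true]
  exact exists_congr fun w' => and_congr_right fun hw' =>
    (hI.sameState_iff hk hw hw').trans eq_comm

theorem isAdequate_iff (hI : IsCoding t d l s) : isAdequate (d, t) (k, m, n, a, b) = true ↔
    detectsEquality t d k (m + 1) = true ∧ contracts t d k m n = true ∧ a < b ∧
      SameStates X (productFamily t s m) a b := by
  simp only [isAdequate, Bool.and_eq_true, decide_eq_true_eq, and_assoc]
  refine and_congr_right fun hk => and_congr_right fun _ => and_congr_right fun _ => ?_
  rw [hI.coversStates_iff hk, hI.coversStates_iff hk]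
  exact Set.Subset.antisymm_iff.symm

theorem exists_isAdequate (hI : IsCoding t d l s) [Finite X] (hcon : IsContracting G X) :
    ∃ c, isAdequate (d, t) c = true := by
  obtain ⟨m, hm⟩ := hI.exists_contracts hcon
  obtain ⟨k, hk⟩ := hI.exists_detectsEquality (m + 1)
  obtain ⟨n, hn⟩ := hm k
  obtain ⟨a, b, hab, hstates⟩ := (hI.contractsTo_productFamily hk hn).exists_sameStates
  exact ⟨(k, m, n, a, b), hI.isAdequate_iff.mpr ⟨hk, hn, hab, hstates⟩⟩

theorem resolves_iff (hI : IsCoding t d l s) (hk : detectsEquality t d k (m + 1) = true)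
    (hw : w ∈ words d n) :
    resolves t d k m w = true ↔ Resolves (productFamily t s m) (w.map l) := by
  simp only [resolves, List.all_eq_true, forall_mem_products, Bool.or_eq_true, Bool.not_eq_true',
    ← Bool.not_eq_true, ← imp_iff_not_or, hI.sameImage_iff hw, sameSection,
    hI.agree_act_iff hk hw hw]
  rfl

theorem vectorOfList_row (hI : IsCoding t d l s) (hk : detectsEquality t d k (m + 1) = true)
    (hw : w ∈ words d n) (i : Fin (products t m).length) :
    vectorOfList (products t m).length ((products t m).map fun v =>
        bif sameImage t w v (products t m)[i] && sameSection t d k w v (products t m)[i]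
        then 1 else 0) =
      classVector (productFamily t s m) (w.map l) i := by
  classical
  funext j
  have hiff : (sameImage t w (products t m)[j] (products t m)[i] &&
      sameSection t d k w (products t m)[j] (products t m)[i]) = true ↔
        transition (productFamily t s m j) (w.map l) =
          transition (productFamily t s m i) (w.map l) := by
    rw [Bool.and_eq_true, hI.sameImage_iff hw, sameSection, hI.agree_act_iff hk hw hw]
    exact Prod.mk_inj.symm
  simp only [vectorOfList, classVector, List.getD_eq_getElem?_getD, List.getElem?_map,
    List.getElem?_eq_getElem j.2, Option.map_some, Option.getD_some, ← hiff, Bool.cond_eq_ite,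
    Fin.getElem_fin]

theorem mem_codedVectors_classRows (hI : IsCoding t d l s)
    (hk : detectsEquality t d k (m + 1) = true) {W : List (List ℕ)}
    (hW : ∀ w ∈ W, ∃ n, w ∈ words d n) {r : Fin (products t m).length → ℕ} :
    r ∈ codedVectors (products t m).length (classRows t d k m W) ↔
      ∃ w ∈ W, ∃ i, classVector (productFamily t s m) (w.map l) i = r := by
  simp only [mem_codedVectors, classRows, List.mem_flatMap, List.mem_map]
  constructor
  · rintro ⟨_, ⟨w, hwW, u, hu, rfl⟩, rfl⟩
    obtain ⟨n, hw⟩ := hW w hwW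
    obtain ⟨i, hi, rfl⟩ := List.getElem_of_mem hu
    exact ⟨w, hwW, ⟨i, hi⟩, (hI.vectorOfList_row hk hw ⟨i, hi⟩).symm⟩
  · rintro ⟨w, hwW, i, rfl⟩
    obtain ⟨n, hw⟩ := hW w hwW
    exact ⟨_, ⟨w, hwW, _, List.getElem_mem i.2, rfl⟩, hI.vectorOfList_row hk hw i⟩

theorem mem_shortResolvingWords (hI : IsCoding t d l s)
    (hk : detectsEquality t d k (m + 1) = true) : w ∈ shortResolvingWords t d k m n ↔
      ∃ a < n, w ∈ words d a ∧ Resolves (productFamily t s m) (w.map l) := by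
  simp only [shortResolvingWords, List.mem_filter, List.mem_flatMap, List.mem_range]
  constructor
  · rintro ⟨⟨a, ha, hw⟩, hres⟩
    exact ⟨a, ha, hw, (hI.resolves_iff hk hw).mp hres⟩
  · rintro ⟨a, ha, hw, hres⟩
    exact ⟨⟨a, ha, hw⟩, (hI.resolves_iff hk hw).mpr hres⟩

theorem codedVectors_shortResolvingWords (hI : IsCoding t d l s)
    (hk : detectsEquality t d k (m + 1) = true) :
    codedVectors (products t m).length (classRows t d k m (shortResolvingWords t d k m n)) =
      shortResolvingVectors X (productFamily t s m) n := by
  ext r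
  rw [hI.mem_codedVectors_classRows hk fun w hw =>
    let ⟨a, _, hwa, _⟩ := (hI.mem_shortResolvingWords hk).mp hw
    ⟨a, hwa⟩]
  constructor
  · rintro ⟨w, hw, i, rfl⟩
    obtain ⟨a, ha, hwa, hres⟩ := (hI.mem_shortResolvingWords hk).mp hw
    exact ⟨w.map l, by simpa [(mem_words.mp hwa).1], hres, i, rfl⟩
  · rintro ⟨z, hz, hres, i, rfl⟩
    obtain ⟨w, hw, rfl⟩ := (hI.bijOn_map_words z.length).surjOn rfl
    exact ⟨w, (hI.mem_shortResolvingWords hk).mpr ⟨_, hz, hw, hres⟩, i, rfl⟩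

theorem noSingular_iff_of_isAdequate (hI : IsCoding t d l s) [Finite X] [Nontrivial X]
    (h : isAdequate (d, t) (k, m, n, a, b) = true) (K : Type*) [Field K] :
    NoSingular G X K ↔
      ∀ r ∈ codedVectors (products t m).length (classRows t d k m (words d a)),
        castVector K r ∈ castSpan K (codedVectors (products t m).length
          (classRows t d k m (shortResolvingWords t d k m b))) := by
  obtain ⟨hk, hn, hab, hstates⟩ := hI.isAdequate_iff.mp h
  rw [noSingular_iff_of_sameStates (hI.contractsTo_productFamily hk hn) hstates hab,
    hI.codedVectors_shortResolvingWords hk, hI.forall_length_eq_iff]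
  simp only [hI.mem_codedVectors_classRows hk fun _ hw => ⟨a, hw⟩]
  grind

theorem exists_mem_decideSimplicity (hI : IsCoding t d l s) [Finite X] [Nontrivial X]
    (hcon : IsContracting G X) : ∃ out ∈ decideSimplicity (d, t),
      (out = none ∧ ¬NoSingular G X ℚ) ∨ ∃ P, out = some P ∧ NoSingular G X ℚ ∧
        ∀ p, p ∈ P ↔ p.Prime ∧ ¬NoSingular G X (ZMod p) := by
  obtain ⟨⟨k, m, n, a, b⟩, hc, hadequate⟩ := exists_mem_findParameters
    (hI.exists_isAdequate hcon)
  obtain ⟨out, hout, hcorrect⟩ := exists_mem_exceptionalPrimes (products t m).length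
    (classRows t d k m (words d a)) (classRows t d k m (shortResolvingWords t d k m b))
  refine ⟨out, Part.mem_bind hc hout, ?_⟩
  rw [IsExceptionalPrimes, ← hI.noSingular_iff_of_isAdequate hadequate ℚ] at hcorrect
  refine hcorrect.imp_right ?_
  rintro ⟨P, rfl, hℚ, hP⟩
  refine ⟨P, rfl, hℚ, fun p => ?_⟩
  refine (hP p).trans (and_congr_right fun hp => ?_)
  have := Fact.mk hp
  rw [hI.noSingular_iff_of_isAdequate hadequate (ZMod p)]

end IsCoding

end Coding

section StateDiagram

variable {G X : Type*} [Group G] [MulAction G (List X)] [SelfSimilarGroup G X]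

namespace Automaton

variable {A : Automaton G X} {d n : ℕ} (eX : Fin d ≃ X) (eA : Fin n ≃ A.states)

/-- The letter with the code `x`, which is taken modulo the number of letters. -/
def codedLetter [NeZero d] (x : ℕ) : X := eX (Fin.ofNat d x)

/-- The group element with the code `c` in the state diagram of an automaton. -/
def codedState (c : ℕ) : G :=
  if h : c / 2 < n then
    if c % 2 = 0 then (eA ⟨c / 2, h⟩ : G) else (eA ⟨c / 2, h⟩ : G)⁻¹
  else 1

theorem codedLetter_val [NeZero d] (x : Fin d) : codedLetter eX x = eX x := by
  rw [codedLetter, Fin.ofNat_val_eq_self]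

theorem codedState_two_mul (i : Fin n) : codedState eA (2 * i) = eA i := by
  simp [codedState]

theorem codedState_two_mul_add_one (i : Fin n) :
    codedState eA (2 * i + 1) = (eA i : G)⁻¹ := by
  have hdiv : (2 * (i : ℕ) + 1) / 2 = i := by omega
  simp [codedState, hdiv]

theorem codedState_two_mul_self : codedState eA (2 * n) = 1 := by
  simp [codedState]

theorem identityCode_stateDiagram : identityCode (A.stateDiagram eX eA).2 = 2 * n := by
  simp [identityCode, stateDiagram]

theorem getD_stateDiagram (i : Fin n) :
    (A.stateDiagram eX eA).2.getD i [] = List.ofFn fun x : Fin d =>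
      (((eX.symm (letter (eA i : G) (eX x)) : Fin d) : ℕ),
        ((eA.symm ⟨sect (eA i : G) (eX x), A.sect_mem _ (eA i).2 _⟩ : Fin n) : ℕ)) := by
  simp [stateDiagram, List.getD_eq_getElem?_getD]

theorem getD_getD_stateDiagram (i : Fin n) (x : Fin d) :
    ((A.stateDiagram eX eA).2.getD i []).getD x (0, 0) =
      (((eX.symm (letter (eA i : G) (eX x)) : Fin d) : ℕ),
        ((eA.symm ⟨sect (eA i : G) (eX x), A.sect_mem _ (eA i).2 _⟩ : Fin n) : ℕ)) := by
  rw [getD_stateDiagram]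
  simp [List.getD_eq_getElem?_getD]

theorem preimage_stateDiagram (i : Fin n) (x : Fin d) :
    preimage ((A.stateDiagram eX eA).2.getD i []) x =
      (eX.symm (letter (eA i : G)⁻¹ (eX x)) : Fin d) := by
  have hletter (y : Fin d) : eX.symm (letter (eA i : G) (eX y)) = x ↔
      y = eX.symm (letter (eA i : G)⁻¹ (eX x)) := by
    rw [Equiv.symm_apply_eq, Equiv.eq_symm_apply]
    constructor <;> intro h
    · rw [← h, letter_inv]
    · simpa only [h, inv_inv] using letter_inv (eA i : G)⁻¹ (eX x)
  rw [preimage, getD_stateDiagram, List.findIdx_eq (by simp)]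
  simp only [List.getElem_ofFn, decide_eq_true_eq, decide_eq_false_iff_not, Fin.val_inj, hletter]
  exact ⟨trivial, fun j hj h => hj.ne (congrArg Fin.val h)⟩

theorem step_two_mul (i : Fin n) (x : Fin d) :
    step (A.stateDiagram eX eA).2 (2 * i) x =
      (((eX.symm (letter (eA i : G) (eX x)) : Fin d) : ℕ),
        2 * ((eA.symm ⟨sect (eA i : G) (eX x), A.sect_mem _ (eA i).2 _⟩ : Fin n) : ℕ)) := by
  have hi : 2 * (i : ℕ) < 2 * n := by omega
  have hdiv : 2 * (i : ℕ) / 2 = i := by omega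
  simp only [step, identityCode_stateDiagram, hi, decide_true, Nat.mul_mod_right, cond_true, hdiv,
    getD_getD_stateDiagram]

theorem step_two_mul_add_one (i : Fin n) (x : Fin d) :
    step (A.stateDiagram eX eA).2 (2 * i + 1) x =
      (((eX.symm (letter (eA i : G)⁻¹ (eX x)) : Fin d) : ℕ),
        2 * ((eA.symm ⟨sect (eA i : G) (letter (eA i : G)⁻¹ (eX x)),
          A.sect_mem _ (eA i).2 _⟩ : Fin n) : ℕ) + 1) := by
  have hi : 2 * (i : ℕ) + 1 < 2 * n := by omega
  have hdiv : (2 * (i : ℕ) + 1) / 2 = i := by omega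
  have hodd : ¬(2 * (i : ℕ) + 1) % 2 = 0 := by omega
  simp only [step, identityCode_stateDiagram, hi, decide_true, cond_true, hodd, decide_false,
    cond_false, hdiv, preimage_stateDiagram, getD_getD_stateDiagram, Equiv.apply_symm_apply]

end Automaton

theorem step_identityCode (t : Table) (x : ℕ) :
    step t (identityCode t) x = (x, identityCode t) := by
  simp [step]

namespace Automaton

variable {A : Automaton G X} {d n : ℕ} (eX : Fin d ≃ X) (eA : Fin n ≃ A.states)

theorem step_stateDiagram [NeZero d] {c : ℕ} (hc : c ≤ 2 * n) (x : Fin d) :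
    ∃ y : Fin d, ∃ b ≤ 2 * n, step (A.stateDiagram eX eA).2 c x = ((y : ℕ), b) ∧
      eX y = letter (codedState eA c) (eX x) ∧
        codedState eA b = sect (codedState eA c) (eX x) := by
  obtain ⟨i, rfl | rfl⟩ | rfl : (∃ i : Fin n, c = 2 * i ∨ c = 2 * i + 1) ∨ c = 2 * n := by
    refine hc.lt_or_eq.imp_left fun hlt => ⟨⟨c / 2, by omega⟩, by dsimp only; omega⟩
  · refine ⟨_, _, ?_, step_two_mul eX eA i x, ?_, ?_⟩
    · omega
    · rw [Equiv.apply_symm_apply, codedState_two_mul]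
    · rw [codedState_two_mul, Equiv.apply_symm_apply, codedState_two_mul]
  · refine ⟨_, _, ?_, step_two_mul_add_one eX eA i x, ?_, ?_⟩
    · omega
    · rw [Equiv.apply_symm_apply, codedState_two_mul_add_one]
    · rw [codedState_two_mul_add_one, Equiv.apply_symm_apply, codedState_two_mul_add_one,
        inv_eq_iff_eq_inv]
      simpa only [inv_inv] using sect_inv (eA i : G)⁻¹ (eX x)
  · refine ⟨x, _, le_rfl, ?_, ?_, ?_⟩
    · rw [← identityCode_stateDiagram eX eA, step_identityCode]
    · rw [codedState_two_mul_self, letter_one]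
    · rw [codedState_two_mul_self, sect_one]

theorem bijOn_codedLetter [NeZero d] : Set.BijOn (codedLetter eX) (Set.Iio d) Set.univ := by
  refine ⟨Set.mapsTo_univ _ _, fun x hx y hy h => ?_, fun x _ => ?_⟩
  · exact congrArg Fin.val (eX.injective ((codedLetter_val eX ⟨x, hx⟩).symm.trans
      (h.trans (codedLetter_val eX ⟨y, hy⟩))))
  · exact ⟨eX.symm x, (eX.symm x).2, by rw [codedLetter_val, Equiv.apply_symm_apply]⟩

theorem exists_codedState_eq {g : G} (hg : g ∈ A.states ∨ g⁻¹ ∈ A.states) :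
    ∃ c < 2 * n, codedState eA c = g := by
  rcases hg with hg | hg
  · refine ⟨2 * eA.symm ⟨g, hg⟩, by omega, ?_⟩
    rw [codedState_two_mul, Equiv.apply_symm_apply]
  · refine ⟨2 * eA.symm ⟨g⁻¹, hg⟩ + 1, by omega, ?_⟩
    rw [codedState_two_mul_add_one, Equiv.apply_symm_apply, inv_inv]

theorem Generates.exists_value_eq (hA : A.Generates) (g : G) :
    ∃ m, ∃ u ∈ words (2 * n + 1) m, value (codedState eA) u = g := by
  have hg : g ∈ Submonoid.closure ((A.states : Set G) ∪ (A.states : Set G)⁻¹) := by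
    rw [← Subgroup.closure_toSubmonoid, Subgroup.mem_toSubmonoid]
    exact (show Subgroup.closure (A.states : Set G) = ⊤ from hA) ▸ Subgroup.mem_top g
  induction hg using Submonoid.closure_induction_left with
  | one => exact ⟨0, [], by simp [words], rfl⟩
  | mul_left a ha b _ ih =>
    obtain ⟨c, hc, rfl⟩ := exists_codedState_eq eA ha
    obtain ⟨m, u, hu, rfl⟩ := ih
    exact ⟨m + 1, c :: u, mem_words_succ.mpr ⟨c, hc.trans_le (Nat.le_succ _), u, hu, rfl⟩,
      by simp [value]⟩

theorem Generates.isCoding (hA : A.Generates) [NeZero d] :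
    IsCoding (A.stateDiagram eX eA).2 d (codedLetter eX) (codedState eA) where
  bijOn_letter := bijOn_codedLetter eX
  step_mem {c x} hc hx := by
    rw [identityCode_stateDiagram] at hc ⊢
    obtain ⟨y, b, hb, hstep, -⟩ := step_stateDiagram eX eA hc ⟨x, hx⟩
    exact hstep ▸ ⟨y.2, hb⟩
  letter_step {c x} hc hx := by
    rw [identityCode_stateDiagram] at hc
    obtain ⟨y, b, -, hstep, hletter, -⟩ := step_stateDiagram eX eA hc ⟨x, hx⟩
    rw [hstep, codedLetter_val, hletter, ← codedLetter_val]
  sect_step {c x} hc hx := by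
    rw [identityCode_stateDiagram] at hc
    obtain ⟨y, b, -, hstep, -, hsect⟩ := step_stateDiagram eX eA hc ⟨x, hx⟩
    rw [hstep, hsect, ← codedLetter_val]
  identityCode_eq_one := by rw [identityCode_stateDiagram, codedState_two_mul_self]
  exists_value_eq g := by
    simpa only [products, identityCode_stateDiagram] using hA.exists_value_eq eA g

end Automaton

end StateDiagram

section Field

variable {G X : Type*} [Group G] [MulAction G (List X)] [SelfSimilarGroup G X]

theorem NoSingular.rat_of_zmod_ringChar [Finite X] (K : Type*) [Field K]
    (h : NoSingular G X (ZMod (ringChar K))) : NoSingular G X ℚ := by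
  rw [noSingular_iff_zmod ℚ 0]
  obtain hp | h0 := CharP.char_is_prime_or_zero K (ringChar K)
  · exact h.int_of_zmod hp
  · exact h0 ▸ h

variable [Fintype X] [Nontrivial X]

theorem isSimpleRing_iff_zmod_ringChar (K : Type*) [Field K] :
    IsSimpleRing (NekrashevychAlgebra K G X) ↔ NoSingular G X (ZMod (ringChar K)) := by
  rw [isSimpleRing_iff_noSingular, noSingular_iff_zmod K (ringChar K)]

theorem not_isSimpleRing_of_not_noSingular_rat (h : ¬NoSingular G X ℚ) (K : Type*) [Field K] :
    ¬IsSimpleRing (NekrashevychAlgebra K G X) := by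
  rw [isSimpleRing_iff_zmod_ringChar]
  exact fun hK => h (hK.rat_of_zmod_ringChar K)

theorem isSimpleRing_iff_not_prime_and_not_noSingular (h : NoSingular G X ℚ) (K : Type*)
    [Field K] : IsSimpleRing (NekrashevychAlgebra K G X) ↔
      ¬((ringChar K).Prime ∧ ¬NoSingular G X (ZMod (ringChar K))) := by
  rw [isSimpleRing_iff_zmod_ringChar]
  obtain hp | h0 := CharP.char_is_prime_or_zero K (ringChar K)
  · simp only [hp, true_and, not_not]
  · rw [h0]
    simpa only [Nat.not_prime_zero, false_and, not_false_iff, iff_true] using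
      (noSingular_iff_zmod ℚ 0).mp h

theorem IsContracting.forall_not_isSimpleRing_or (hcon : IsContracting G X) :
    (∀ (K : Type w) [Field K], ¬IsSimpleRing (NekrashevychAlgebra K G X)) ∨
      ∃ P : Finset ℕ, (∀ p ∈ P, p.Prime) ∧ ∀ (K : Type w) [Field K],
        (IsSimpleRing (NekrashevychAlgebra K G X) ↔ ringChar K ∉ P) := by
  by_cases h : NoSingular G X ℚ
  · have hfin := hcon.finite_setOf_not_noSingular_zmod h
    refine .inr ⟨hfin.toFinset, fun p hp => (hfin.mem_toFinset.mp hp).1, fun K _ => ?_⟩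
    rw [isSimpleRing_iff_not_prime_and_not_noSingular h, hfin.mem_toFinset]
    rfl
  · exact .inl fun K _ => not_isSimpleRing_of_not_noSingular_rat h K

theorem Automaton.Generates.exists_mem_decideSimplicity {A : Automaton G X} (hA : A.Generates)
    (hcon : IsContracting G X) {d n : ℕ} [NeZero d] (eX : Fin d ≃ X) (eA : Fin n ≃ A.states) :
    ∃ out ∈ decideSimplicity (A.stateDiagram eX eA),
      (out = none ∧ ∀ (K : Type w) [Field K], ¬IsSimpleRing (NekrashevychAlgebra K G X)) ∨
        ∃ P : List ℕ, out = some P ∧ (∀ p ∈ P, p.Prime) ∧ ∀ (K : Type w) [Field K],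
          (IsSimpleRing (NekrashevychAlgebra K G X) ↔ ringChar K ∉ P) := by
  obtain ⟨out, hout, hcorrect⟩ := (hA.isCoding eX eA).exists_mem_decideSimplicity hcon
  refine ⟨out, hout, ?_⟩
  obtain ⟨rfl, h⟩ | ⟨P, rfl, h, hP⟩ := hcorrect
  · exact .inl ⟨rfl, fun K _ => not_isSimpleRing_of_not_noSingular_rat h K⟩
  · refine .inr ⟨P, rfl, fun p hp => ((hP p).mp hp).1, fun K _ => ?_⟩
    rw [isSimpleRing_iff_not_prime_and_not_noSingular h, hP]

end Field
end SelfSimilarGroup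

theorem theoremt_general :
    (∀ (X : Type u) [Fintype X] (G : Type v) [Group G] [MulAction G (List X)]
        [SelfSimilarGroup G X], 2 ≤ Fintype.card X →
      (∀ (K : Type w) [Field K] (L : Type w') [Field L], ringChar K = ringChar L →
        (IsSimpleRing (SelfSimilarGroup.NekrashevychAlgebra K G X) ↔
          IsSimpleRing (SelfSimilarGroup.NekrashevychAlgebra L G X))) ∧
      (SelfSimilarGroup.IsContracting G X →
        (∀ (K : Type w) [Field K],
          ¬ IsSimpleRing (SelfSimilarGroup.NekrashevychAlgebra K G X)) ∨
        ∃ P : Finset ℕ, (∀ p ∈ P, p.Prime) ∧ ∀ (K : Type w) [Field K],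
          (IsSimpleRing (SelfSimilarGroup.NekrashevychAlgebra K G X) ↔ ringChar K ∉ P))) ∧
    ∃ f : ℕ × List (List (ℕ × ℕ)) →. Option (List ℕ), Partrec f ∧
      ∀ (X : Type u) [Fintype X] (G : Type v) [Group G] [MulAction G (List X)]
        [SelfSimilarGroup G X], 2 ≤ Fintype.card X →
        ∀ A : SelfSimilarGroup.Automaton G X, A.Generates →
        SelfSimilarGroup.IsContracting G X →
        ∀ (d n : ℕ) (eX : Fin d ≃ X) (eA : Fin n ≃ A.states),
      ∃ out ∈ f (A.stateDiagram eX eA),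
        (out = none ∧ ∀ (K : Type w) [Field K],
          ¬ IsSimpleRing (SelfSimilarGroup.NekrashevychAlgebra K G X)) ∨
        ∃ P : List ℕ, out = some P ∧ (∀ p ∈ P, p.Prime) ∧ ∀ (K : Type w) [Field K],
          (IsSimpleRing (SelfSimilarGroup.NekrashevychAlgebra K G X) ↔ ringChar K ∉ P) := by
  refine ⟨fun X _ G _ _ _ hX => ?_, SelfSimilarGroup.decideSimplicity,
    SelfSimilarGroup.partrec_decideSimplicity, fun X _ G _ _ _ hX A hA hcon d n eX eA => ?_⟩
  · have : Nontrivial X := Fintype.one_lt_card_iff_nontrivial.mp hX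
    refine ⟨fun K _ L _ hKL => ?_, SelfSimilarGroup.IsContracting.forall_not_isSimpleRing_or⟩
    rw [SelfSimilarGroup.isSimpleRing_iff_zmod_ringChar,
      SelfSimilarGroup.isSimpleRing_iff_zmod_ringChar, hKL]
  · have : Nontrivial X := Fintype.one_lt_card_iff_nontrivial.mp hX
    have : NeZero d := ⟨by rintro rfl; simp [← Fintype.card_congr eX] at hX⟩
    exact hA.exists_mem_decideSimplicity hcon eX eA

/-- First conjunct: for a contracting self-similar group generated by a finite automaton,
simplicity of the Nekrashevych algebra depends only on the characteristic of the field, and either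
the algebra is non-simple over all fields, or there is a finite set of primes such that it is simple
exactly over the fields whose characteristic is not in that set. Second conjunct: a single algorithm
halts on the state diagram of every such automaton, decides which case holds, and in the second
case outputs that set of primes. It outputs `none` in the first case, and the list of the
exceptional primes in the second one. -/
theorem theoremt :
    (∀ (X : Type u) [Fintype X] (G : Type v) [Group G] [MulAction G (List X)]
        [SelfSimilarGroup G X], 2 ≤ Fintype.card X →
        ∀ A : SelfSimilarGroup.Automaton G X, A.Generates →
        SelfSimilarGroup.IsContracting G X →
      (∀ (K : Type w) [Field K] (L : Type w') [Field L], ringChar K = ringChar L →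
        (IsSimpleRing (SelfSimilarGroup.NekrashevychAlgebra K G X) ↔
          IsSimpleRing (SelfSimilarGroup.NekrashevychAlgebra L G X))) ∧
      ((∀ (K : Type w) [Field K],
          ¬ IsSimpleRing (SelfSimilarGroup.NekrashevychAlgebra K G X)) ∨
        ∃ P : Finset ℕ, (∀ p ∈ P, p.Prime) ∧ ∀ (K : Type w) [Field K],
          (IsSimpleRing (SelfSimilarGroup.NekrashevychAlgebra K G X) ↔ ringChar K ∉ P))) ∧
    ∃ f : ℕ × List (List (ℕ × ℕ)) →. Option (List ℕ), Partrec f ∧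
      ∀ (X : Type u) [Fintype X] (G : Type v) [Group G] [MulAction G (List X)]
        [SelfSimilarGroup G X], 2 ≤ Fintype.card X →
        ∀ A : SelfSimilarGroup.Automaton G X, A.Generates →
        SelfSimilarGroup.IsContracting G X →
        ∀ (d n : ℕ) (eX : Fin d ≃ X) (eA : Fin n ≃ A.states),
      ∃ out ∈ f (A.stateDiagram eX eA),
        (out = none ∧ ∀ (K : Type w) [Field K],
          ¬ IsSimpleRing (SelfSimilarGroup.NekrashevychAlgebra K G X)) ∨
        ∃ P : List ℕ, out = some P ∧ (∀ p ∈ P, p.Prime) ∧ ∀ (K : Type w) [Field K],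
          (IsSimpleRing (SelfSimilarGroup.NekrashevychAlgebra K G X) ↔ ringChar K ∉ P) :=
  ⟨fun X _ G _ _ _ hX _ _ hcon => (theoremt_general.1 X G hX).imp_right fun h => h hcon,
    theoremt_general.{u, v, w, w'}.2⟩
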